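/- **Theorem 1.** Let $n,p\ge 1$, let $\mathbf X$ be a fixed real $n\times p$ matrix with columns $\mathbf x_1,\dots,\mathbf x_p$, let $\beta\in\mathbb R^p$, and let $c_0\ge 0$, $a_n\ge 0$ be real numbers. For $\mathbf y=\mathbf X\beta+\varepsilon$ and a penalty level $\lambda$ let $\hat\beta=\hat\beta(\lambda)$ be a LASSO estimate, i.e. a minimizer over $b\in\mathbb R^p$ of $\|\mathbf y-\mathbf Xb\|^2/2+\lambda\sum_j|b_j|$, let $\hat A(\lambda)=\{j:\hat\beta_j\ne 0\}$, and let $\hat{\mathbf P}(\lambda)$ be the orthogonal projection of $\mathbb R^n$ onto the span of $\{\mathbf x_j:j\in\hat A(\lambda)\}$. Then there is a Borel set $\Omega_0\subseteq\mathbb R^n$, depending on $\{\mathbf X,\beta,c_0,a_n\}$ only, with the following property. Let $\sigma>0$ and $\varepsilon\sim N(0,\sigma^2\mathbf I_n)$. Let $A_0\subseteq\{1,\dots,p\}$, an integer $q\ge 1$ and $\eta_1$ satisfy the sparsity condition $$\#\{j\le p: j\notin A_0\}=q,\qquad \sum_{j\in A_0}|\beta_j|\le\eta_1 ,$$ and let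 $\mathbf X$ satisfy the sparse Riesz condition with rank $q^*\le p$ and spectrum bounds $0<c_*<c^*<\infty$: $$c_*\le\frac{\|\mathbf X_A v\|^2}{n\|v\|^2}\le c^*\qquad\text{for all } A\subseteq\{1,\dots,p\}\text{ with }|A|=q^*\text{ and all } 0\ne v\in\mathbb R^{A},$$ where $\mathbf X_A=(\mathbf x_j)_{j\in A}$. Put $\eta_2=\max_{A\subseteq A_0}\|\sum_{j\in A}\beta_j\mathbf x_j\|$, $C=c^*/c_*$, and for $\lambda>0$ $$r_1=\Big(\frac{c^*\eta_1n}{q\lambda}\Big)^{1/2},\qquad r_2=\Big(\frac{c^*\eta_2^2n}{q\lambda^2}\Big)^{1/2}$$ (with $r_1=r_2=0$ if $\eta_1=0$, also at $\lambda=0$), $$M_1^*(\lambda)=2+4r_1^2+4\sqrt C\,r_2+4C,$$ $$M_2^*(\lambda)=\tfrac83\Big\{\tfrac14+r_1^2+r_2\sqrt{2C}(1+\sqrt C)+C\big(\tfrac12+\tfrac43C\big)\Big\},$$ $$M_3^*(\lambda)=\tfrac83\Big\{\tfrac14+r_1^2+r_2\sqrt C\,(1+2\sqrt{1+C})+\tfrac34r_2^2+C\big(\tfrac76+\tfrac23C\big)\Big\},$$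 $$\lambda_*=\inf\{\lambda>0:M_1^*(\lambda)q+1\le q^*\}\ (\inf\emptyset=\infty),\qquad \lambda_{n,p}=2\sigma\sqrt{2(1+c_0)c^*n\log(p\vee a_n)} .$$ Then $$P\{\varepsilon/\sigma\in\Omega_0\}\ \ge\ 2-\exp\Big(\frac{2p}{(p\vee a_n)^{1+c_0}}\Big)-\frac{2}{(p\vee a_n)^{1+c_0}},$$ and in the event $\varepsilon/\sigma\in\Omega_0$, for every (finite) $\lambda\ge\max(\lambda_*,\lambda_{n,p})$ and every LASSO estimate $\hat\beta(\lambda)$, $$\#\{j:\hat\beta_j(\lambda)\ne0\}\ \le\ \#\{j:\hat\beta_j(\lambda)\ne0\text{ or }j\notin A_0\}\ \le\ M_1^*(\lambda)\,q,$$ $$\|(\mathbf I-\hat{\mathbf P}(\lambda))\mathbf X\beta\|^2\ \le\ M_2^*(\lambda)\frac{q\lambda^2}{c^*n},$$ $$\sum_{j\notin A_0}|\beta_j|^2\,I\{\hat\beta_j(\lambda)=0\}\ \le\ M_3^*(\lambda)\frac{q\lambda^2}{c^*c_*n^2}.$$ -/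

import Mathlib

open MeasureTheory ProbabilityTheory

noncomputable section

namespace LassoRate

variable {n p : ℕ}

/-- The `j`-th design vector `x_j ∈ ℝⁿ`, i.e. the `j`-th column of the design matrix. -/
def designVec (X : Matrix (Fin n) (Fin p) ℝ) (j : Fin p) : EuclideanSpace ℝ (Fin n) :=
  WithLp.toLp 2 (fun i => X i j)

/-- The vector `X b = ∑ⱼ bⱼ xⱼ ∈ ℝⁿ`. -/
def linPred (X : Matrix (Fin n) (Fin p) ℝ) (b : Fin p → ℝ) : EuclideanSpace ℝ (Fin n) :=
  ∑ j, b j • designVec X j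

/-- The LASSO criterion `‖y - X b‖² / 2 + l ‖b‖₁` with penalty level `l`. -/
def lassoObj (X : Matrix (Fin n) (Fin p) ℝ) (y : EuclideanSpace ℝ (Fin n)) (l : ℝ)
    (b : Fin p → ℝ) : ℝ :=
  ‖y - linPred X b‖ ^ 2 / 2 + l * ∑ j, |b j|

/-- `b` is a LASSO estimate: a global minimizer of the LASSO criterion. -/
def IsLasso (X : Matrix (Fin n) (Fin p) ℝ) (y : EuclideanSpace ℝ (Fin n)) (l : ℝ)
    (b : Fin p → ℝ) : Prop :=
  ∀ b' : Fin p → ℝ, lassoObj X y l b ≤ lassoObj X y l b'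

/-- The selected model `{j : bⱼ ≠ 0}`. -/
def selected (b : Fin p → ℝ) : Finset (Fin p) :=
  Finset.univ.filter fun j => b j ≠ 0

/-- The bias `‖(I - P̂) X β‖` of the model selected by `b`, where `P̂` is the orthogonal projection
onto the span of the selected design vectors. -/
def bias (X : Matrix (Fin n) (Fin p) ℝ) (β b : Fin p → ℝ) : ℝ :=
  ‖linPred X β -
    (Submodule.span ℝ (designVec X '' (selected b : Set (Fin p)))).starProjection (linPred X β)‖

/-- The squared norm `∑_{j ∉ A0} |βⱼ|² I{bⱼ = 0}` of the missed large coefficients. -/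
def missedSq (β : Fin p → ℝ) (A0 : Finset (Fin p)) (b : Fin p → ℝ) : ℝ :=
  ∑ j ∈ A0ᶜ, if b j = 0 then |β j| ^ 2 else 0

/-- Sparsity: exactly `q` indices lie outside `A0`, and the coefficients inside `A0` have total
`ℓ₁`-mass at most `η₁`. -/
def Sparsity (β : Fin p → ℝ) (A0 : Finset (Fin p)) (q : ℕ) (η₁ : ℝ) : Prop :=
  (A0ᶜ).card = q ∧ ∑ j ∈ A0, |β j| ≤ η₁

/-- `η₂ = max_{A ⊆ A0} ‖∑_{j ∈ A} βⱼ xⱼ‖`. -/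
def eta2 (X : Matrix (Fin n) (Fin p) ℝ) (β : Fin p → ℝ) (A0 : Finset (Fin p)) : ℝ :=
  A0.powerset.sup' (Finset.powerset_nonempty A0) fun A => ‖∑ j ∈ A, β j • designVec X j‖

/-- The sparse Riesz condition with rank `qs` (at most the number `p` of design vectors) and
spectrum bounds `0 < cl < cu`: for all `A` with `|A| = qs` and `0 ≠ v ∈ ℝ^A`,
`cl ≤ ‖X_A v‖² / (n ‖v‖²) ≤ cu`. -/
def SparseRiesz (X : Matrix (Fin n) (Fin p) ℝ) (qs : ℕ) (cl cu : ℝ) : Prop :=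
  qs ≤ p ∧ 0 < cl ∧ cl < cu ∧
    ∀ A : Finset (Fin p), A.card = qs → ∀ v : EuclideanSpace ℝ A, v ≠ 0 →
      cl ≤ ‖∑ j : A, v j • designVec X j‖ ^ 2 / (n * ‖v‖ ^ 2) ∧
      ‖∑ j : A, v j • designVec X j‖ ^ 2 / (n * ‖v‖ ^ 2) ≤ cu

/-- The ratio `r₁ = (c^* η₁ n / (q l))^{1/2}`. -/
def r₁ (n q : ℕ) (η₁ cu l : ℝ) : ℝ := √(cu * η₁ * n / (q * l))

/-- The ratio `r₂ = (c^* η₂² n / (q l²))^{1/2}`. -/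
def r₂ (n q : ℕ) (η₂ cu l : ℝ) : ℝ := √(cu * η₂ ^ 2 * n / (q * l ^ 2))

/-- `M₁^*(l) = 2 + 4 r₁² + 4 √C r₂ + 4 C` with `C = c^* / c_*`. -/
def M₁ (n q : ℕ) (η₁ η₂ cl cu l : ℝ) : ℝ :=
  2 + 4 * r₁ n q η₁ cu l ^ 2 + 4 * √(cu / cl) * r₂ n q η₂ cu l + 4 * (cu / cl)

/-- `M₂^*(l) = (8/3) {1/4 + r₁² + r₂ √(2C) (1 + √C) + C (1/2 + 4C/3)}`. -/
def M₂ (n q : ℕ) (η₁ η₂ cl cu l : ℝ) : ℝ :=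
  8 / 3 * (1 / 4 + r₁ n q η₁ cu l ^ 2
    + r₂ n q η₂ cu l * √(2 * (cu / cl)) * (1 + √(cu / cl))
    + (cu / cl) * (1 / 2 + 4 / 3 * (cu / cl)))

/-- `M₃^*(l) = (8/3) {1/4 + r₁² + r₂ √C (1 + 2 √(1 + C)) + 3 r₂² / 4 + C (7/6 + 2C/3)}`. -/
def M₃ (n q : ℕ) (η₁ η₂ cl cu l : ℝ) : ℝ :=
  8 / 3 * (1 / 4 + r₁ n q η₁ cu l ^ 2
    + r₂ n q η₂ cu l * √(cu / cl) * (1 + 2 * √(1 + cu / cl))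
    + 3 * r₂ n q η₂ cu l ^ 2 / 4
    + (cu / cl) * (7 / 6 + 2 / 3 * (cu / cl)))

/-- `λ_* = inf {l > 0 : M₁^*(l) q + 1 ≤ q^*}`, with `inf ∅ = ∞`. -/
def lamStar (n q qs : ℕ) (η₁ η₂ cl cu : ℝ) : EReal :=
  sInf ((fun l : ℝ => (l : EReal)) '' {l : ℝ | 0 < l ∧ M₁ n q η₁ η₂ cl cu l * q + 1 ≤ qs})

/-- `λ_{n,p} = 2 σ √(2 (1 + c₀) c^* n log (p ∨ aₙ))`. -/
def lamNP (n p : ℕ) (σ c₀ a cu : ℝ) : ℝ :=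
  2 * σ * √(2 * (1 + c₀) * cu * n * Real.log (max (p : ℝ) a))

end LassoRate

end

open LassoRate

/-!
The proof works with the Karush–Kuhn–Tucker conditions only. Write `C = c^*/c_*`, let `A` be a model
containing the selected indices whose small members (those in `A0`) have maximal correlation `± l`
with the residual, let `V₃` and `V₄` be `l X_A (X_Aᵀ X_A)⁻¹ s` with the scaled correlations `s` kept
on the large, respectively small, members of `A` and replaced by `0` on the others, and let
`ω = (I - P_A) X β`. Pairing the conditions inside `A` with `V₄` and those outside `A` with `β` and
adding up cancels the cross terms between `V₄` and `X β` (`IsKKT.energy_le`), and leaves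
`‖V₄‖² + ‖ω‖²` bounded by terms in `V₃` and the missed large coefficients, which the sparse Riesz
condition controls, by `l η₁`, and by the single noise term `⟪V₄ - ω, ε⟫`.

For every `l`, the vector `V₄ - ω` lies in one plane that depends on `A` and on a pattern of signs
in `{-1, 0, 1}` on `A` only (`noisePlane`). The good event asks that the standardised noise has a
projection of squared length at most `2 (1 + c₀) (|A| ∨ 1) log (p ∨ a)` on each of these planes.
The `χ²₂` tail is exactly `exp (-t / 2)`, so with `x = (p ∨ a)^{-(1 + c₀)}` the plane of a pattern
fails with probability at most `x ^ (|A| ∨ 1)`; a pattern that is not all zero differs from its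
opposite and shares its plane, so the union bound gives `((1 + 3 x)^p - 1) / 2 + x`, which is below
`exp (2 p x) - 1 + 2 x` whenever the asserted bound is not trivial (`three_sign_count_le`). On the
good event and for `l ≥ λ_{n,p}`, the noise term is at most `(‖V₄‖² + D²)^{1/2} (‖V₄‖² + ‖ω‖²)^{1/2}
/ 2` with `D² = q l² / (c^* n)`, because `‖V₄‖²` is at least `l² / (c^* n)` times the number of
small members of `A`. This is
`IsKKT.basic_inequality`; completing squares turns it into the three bounds, the first with `A` the
selected set enlarged by all large indices, the other two with `A` the selected set.

The basic inequality presupposes `|A ∪ A0ᶜ| ≤ q^*`, which follows by continuity along the LASSO path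
(`card_selected_union_lt`): from `λ_*` on, a model of size at most `q^*` has size at most
`M₁ q ≤ q^* - 1`, so the size cannot cross `q^*` as the penalty decreases from large values, where
nothing is selected.
-/

open LassoRate
open scoped RealInnerProductSpace ENNReal

/-! ### The chi-squared tail of a Gaussian vector projected on a plane -/

lemma lintegral_Ioi_mul_exp_neg_sq_div_two {a : ℝ} (ha : 0 ≤ a) :
    ∫⁻ r in Set.Ioi a, ENNReal.ofReal (r * Real.exp (-r ^ 2 / 2))
      = ENNReal.ofReal (Real.exp (-a ^ 2 / 2)) := by
  have hd : ∀ r ∈ Set.Ici a, HasDerivAt (fun r : ℝ => -Real.exp (-r ^ 2 / 2))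
      (r * Real.exp (-r ^ 2 / 2)) r := by
    intro r _
    have h1 : HasDerivAt (fun r : ℝ => -r ^ 2 / 2) (-r) r := by
      have := ((hasDerivAt_id r).pow 2).neg.div_const 2
      have h0 : HasDerivAt (fun r : ℝ => -r ^ 2 / 2) (-(2 * r) / 2) r := by simpa using this
      rwa [show -(2 * r) / 2 = -r by ring] at h0
    have h2 : HasDerivAt (fun r : ℝ => -Real.exp (-r ^ 2 / 2))
        (-(Real.exp (-r ^ 2 / 2) * -r)) r := h1.exp.neg
    rwa [show -(Real.exp (-r ^ 2 / 2) * -r) = r * Real.exp (-r ^ 2 / 2) by ring] at h2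
  have hpos : ∀ r ∈ Set.Ioi a, 0 ≤ r * Real.exp (-r ^ 2 / 2) := fun r hr =>
    mul_nonneg (ha.trans (le_of_lt hr)) (Real.exp_pos _).le
  have hlim : Filter.Tendsto (fun r : ℝ => -Real.exp (-r ^ 2 / 2)) Filter.atTop (nhds 0) := by
    rw [← neg_zero]
    refine (Real.tendsto_exp_atBot.comp ?_).neg
    have : Filter.Tendsto (fun r : ℝ => r ^ 2 / 2) Filter.atTop Filter.atTop :=
      (Filter.tendsto_pow_atTop two_ne_zero).atTop_div_const two_pos
    refine (Filter.tendsto_neg_atTop_atBot.comp this).congr fun r => ?_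
    simp [neg_div]
  rw [← ofReal_integral_eq_lintegral_ofReal
    (integrableOn_Ioi_deriv_of_nonneg' hd hpos hlim)
    ((ae_restrict_iff' measurableSet_Ioi).2 (Filter.Eventually.of_forall hpos)),
    integral_Ioi_of_hasDerivAt_of_tendsto' hd
    (integrableOn_Ioi_deriv_of_nonneg' hd hpos hlim) hlim]
  simp

/-- The `χ²₂` tail is exactly `exp (-t / 2)`, by polar coordinates. -/
lemma gaussianReal_prod_tail {t : ℝ} (ht : 0 ≤ t) :
    ((gaussianReal 0 1).prod (gaussianReal 0 1)) {z : ℝ × ℝ | t < z.1 ^ 2 + z.2 ^ 2}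
      = ENNReal.ofReal (Real.exp (-t / 2)) := by
  have hS : MeasurableSet {z : ℝ × ℝ | t < z.1 ^ 2 + z.2 ^ 2} :=
    measurableSet_lt measurable_const (by fun_prop)
  have hpdf : ∀ z : ℝ × ℝ, gaussianPDF 0 1 z.1 * gaussianPDF 0 1 z.2
      = ENNReal.ofReal ((2 * Real.pi)⁻¹ * Real.exp (-(z.1 ^ 2 + z.2 ^ 2) / 2)) := by
    intro z
    rw [gaussianPDF, gaussianPDF, ← ENNReal.ofReal_mul (gaussianPDFReal_nonneg _ _ _),
      gaussianPDFReal, gaussianPDFReal]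
    congr 1
    have h2 : (√(2 * Real.pi * ((1 : NNReal) : ℝ)))⁻¹ * (√(2 * Real.pi * ((1 : NNReal) : ℝ)))⁻¹
        = (2 * Real.pi)⁻¹ := by
      rw [← mul_inv, Real.mul_self_sqrt (by positivity)]; simp
    rw [mul_mul_mul_comm, h2, ← Real.exp_add]
    congr 2
    simp
    ring
  rw [gaussianReal_of_var_ne_zero _ one_ne_zero,
    prod_withDensity (measurable_gaussianPDF 0 1) (measurable_gaussianPDF 0 1),
    withDensity_apply _ hS, ← lintegral_indicator hS]
  rw [← Measure.volume_eq_prod, ← lintegral_comp_polarCoord_symm, polarCoord_target,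
    Measure.volume_eq_prod, ← Measure.prod_restrict]
  have hst : √t ^ 2 = t := Real.sq_sqrt ht
  have hrw : ∀ z ∈ Set.Ioi (0 : ℝ) ×ˢ Set.Ioo (-Real.pi) Real.pi,
      ENNReal.ofReal z.1 • Set.indicator {z : ℝ × ℝ | t < z.1 ^ 2 + z.2 ^ 2}
        (fun z => gaussianPDF 0 1 z.1 * gaussianPDF 0 1 z.2) (polarCoord.symm z)
      = Set.indicator (Set.Ioi (√t))
        (fun r => ENNReal.ofReal (r * Real.exp (-r ^ 2 / 2))) z.1
          * ENNReal.ofReal ((2 * Real.pi)⁻¹) := by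
    rintro ⟨r, θ⟩ ⟨hr, -⟩
    have hr : 0 < r := hr
    have hsq : (r * Real.cos θ) ^ 2 + (r * Real.sin θ) ^ 2 = r ^ 2 := by
      rw [mul_pow, mul_pow, ← mul_add, Real.cos_sq_add_sin_sq, mul_one]
    by_cases h : √t < r
    · rw [Set.indicator_of_mem (s := Set.Ioi (√t)) h, Set.indicator_of_mem, hpdf]
      · simp only [polarCoord_symm_apply, hsq, smul_eq_mul]
        rw [← ENNReal.ofReal_mul hr.le, ← ENNReal.ofReal_mul (by positivity)]
        congr 1; ring
      · simp only [polarCoord_symm_apply, Set.mem_ofPred_eq, hsq]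
        exact (Real.sqrt_lt' hr).1 h
    · rw [Set.indicator_of_notMem (s := Set.Ioi (√t)) h, Set.indicator_of_notMem]
      · simp
      · simp only [polarCoord_symm_apply, Set.mem_ofPred_eq, hsq]
        exact fun h' => h ((Real.sqrt_lt' hr).2 h')
  have hm : Measurable fun z : ℝ × ℝ => Set.indicator (Set.Ioi (√t))
      (fun r => ENNReal.ofReal (r * Real.exp (-r ^ 2 / 2))) z.1 :=
    Measurable.comp (g := Set.indicator (Set.Ioi (√t))
      (fun r => ENNReal.ofReal (r * Real.exp (-r ^ 2 / 2))))
      (Measurable.indicator (by fun_prop) measurableSet_Ioi) measurable_fst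
  rw [Measure.prod_restrict, setLIntegral_congr_fun (measurableSet_Ioi.prod measurableSet_Ioo) hrw,
    ← Measure.prod_restrict, lintegral_mul_const _ hm]
  rw [lintegral_prod _ hm.aemeasurable]
  simp only [lintegral_const, Measure.restrict_apply_univ, Real.volume_Ioo]
  rw [lintegral_mul_const _ (Measurable.indicator (by fun_prop) measurableSet_Ioi),
    lintegral_indicator measurableSet_Ioi, Measure.restrict_restrict measurableSet_Ioi,
    Set.inter_eq_left.2 (Set.Ioi_subset_Ioi (Real.sqrt_nonneg t)),
    lintegral_Ioi_mul_exp_neg_sq_div_two (Real.sqrt_nonneg t), hst, mul_assoc,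
    ← ENNReal.ofReal_mul (by linarith [Real.pi_pos])]
  have : (Real.pi - -Real.pi) * (2 * Real.pi)⁻¹ = 1 := by
    have := Real.pi_pos.ne'
    field_simp; ring
  rw [this]; simp

lemma pi_gaussianReal_tail {d : ℕ} (hd : d ≤ 2) {t : ℝ} (ht : 0 ≤ t) :
    (Measure.pi fun _ : Fin d => gaussianReal 0 1) {x | t < ∑ i, x i ^ 2}
      ≤ ENNReal.ofReal (Real.exp (-t / 2)) := by
  interval_cases d
  · simp [ht.not_gt]
  · have h := (measurePreserving_funUnique (gaussianReal 0 1) (Fin 1))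
    have h' : {x : Fin 1 → ℝ | t < ∑ i, x i ^ 2}
        = MeasurableEquiv.funUnique (Fin 1) ℝ ⁻¹' {z | t < z ^ 2} := by
      ext x; simp [MeasurableEquiv.funUnique]
    have hm : MeasurableSet {z : ℝ | t < z ^ 2} := measurableSet_lt measurable_const (by fun_prop)
    rw [h', show (Measure.pi fun _ : Fin 1 => gaussianReal 0 1) _ = _ from
      h.measure_preimage hm.nullMeasurableSet, ← gaussianReal_prod_tail ht]
    calc gaussianReal 0 1 {z : ℝ | t < z ^ 2}
        = ((gaussianReal 0 1).prod (gaussianReal 0 1)) (Prod.fst ⁻¹' {z : ℝ | t < z ^ 2}) := by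
          rw [measurePreserving_fst.measure_preimage hm.nullMeasurableSet]
      _ ≤ _ := measure_mono fun z (hz : t < z.1 ^ 2) =>
          show t < z.1 ^ 2 + z.2 ^ 2 by nlinarith [sq_nonneg z.2]
  · have h := (measurePreserving_finTwoArrow (gaussianReal 0 1))
    have h' : {x : Fin 2 → ℝ | t < ∑ i, x i ^ 2}
        = MeasurableEquiv.finTwoArrow ⁻¹' {z : ℝ × ℝ | t < z.1 ^ 2 + z.2 ^ 2} := by
      ext x; simp [MeasurableEquiv.finTwoArrow, Fin.sum_univ_two]
    have hm : MeasurableSet {z : ℝ × ℝ | t < z.1 ^ 2 + z.2 ^ 2} :=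
      measurableSet_lt measurable_const (by fun_prop)
    rw [h', h.measure_preimage hm.nullMeasurableSet, gaussianReal_prod_tail ht]

section Projection

variable {E : Type*} [NormedAddCommGroup E] [InnerProductSpace ℝ E] [FiniteDimensional ℝ E]
  [MeasurableSpace E] [BorelSpace E]

lemma stdGaussian_map_orthogonalProjection (W : Submodule ℝ E) :
    (stdGaussian E).map W.orthogonalProjectionOnto = stdGaussian W := by
  have : IsFiniteMeasure ((stdGaussian E).map W.orthogonalProjectionOnto) := by infer_instance
  apply Measure.ext_of_charFun
  ext w
  rw [charFun_stdGaussian, charFun_apply,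
    integral_map W.orthogonalProjectionOnto.continuous.measurable.aemeasurable (by fun_prop)]
  simp only [Submodule.inner_orthogonalProjectionOnto_eq_of_mem_right]
  have := charFun_stdGaussian (w : E)
  rw [charFun_apply] at this
  simpa using this

/-- The projection of a standard Gaussian vector on a subspace of dimension at most two has
squared norm stochastically dominated by `χ²₂`. -/
lemma stdGaussian_projection_tail {W : Submodule ℝ E} (hW : Module.finrank ℝ W ≤ 2) {t : ℝ}
    (ht : 0 ≤ t) :
    stdGaussian E {e | t < ‖W.orthogonalProjectionOnto e‖ ^ 2} ≤ ENNReal.ofReal (Real.exp (-t / 2)) := by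
  have hm : MeasurableSet {w : W | t < ‖w‖ ^ 2} := measurableSet_lt measurable_const (by fun_prop)
  have h1 : stdGaussian E {e | t < ‖W.orthogonalProjectionOnto e‖ ^ 2}
      = stdGaussian W {w | t < ‖w‖ ^ 2} := by
    rw [← stdGaussian_map_orthogonalProjection W,
      Measure.map_apply W.orthogonalProjectionOnto.continuous.measurable hm]
    rfl
  rw [h1, stdGaussian, Measure.map_apply (by fun_prop) hm]
  refine le_trans (le_of_eq ?_) (pi_gaussianReal_tail hW ht)
  congr 1
  ext x
  have : ‖∑ i, x i • stdOrthonormalBasis ℝ W i‖ ^ 2 = ∑ i, x i ^ 2 := by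
    rw [← (stdOrthonormalBasis ℝ W).sum_sq_norm_inner_right]
    refine Finset.sum_congr rfl fun i _ => ?_
    rw [(stdOrthonormalBasis ℝ W).orthonormal.inner_right_fintype, Real.norm_eq_abs, sq_abs]
  change t < _ ↔ t < _
  rw [this]

end Projection

lemma smul_hasLaw_stdGaussian {n : ℕ} {Ω : Type*} [MeasurableSpace Ω] {P : Measure Ω}
    {ε : Ω → EuclideanSpace ℝ (Fin n)} {σ : ℝ} (hσ : 0 < σ)
    (h : HasLaw ε (multivariateGaussian 0 ((σ ^ 2) • (1 : Matrix (Fin n) (Fin n) ℝ))) P) :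
    HasLaw (fun ω => σ⁻¹ • ε ω) (stdGaussian (EuclideanSpace ℝ (Fin n))) P := by
  have hS : ((σ ^ 2) • (1 : Matrix (Fin n) (Fin n) ℝ)).PosSemidef :=
    Matrix.PosSemidef.one.smul (by positivity)
  have key : (multivariateGaussian 0 ((σ ^ 2) • (1 : Matrix (Fin n) (Fin n) ℝ))).map
      (fun x => σ⁻¹ • x) = stdGaussian (EuclideanSpace ℝ (Fin n)) := by
    have : IsFiniteMeasure ((multivariateGaussian 0
        ((σ ^ 2) • (1 : Matrix (Fin n) (Fin n) ℝ))).map (fun x => σ⁻¹ • x)) := by infer_instance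
    apply Measure.ext_of_charFun
    ext t
    rw [charFun_map_smul, charFun_multivariateGaussian hS, charFun_stdGaussian]
    congr 1
    have h2 : ((σ⁻¹ • t).ofLp ⬝ᵥ (σ ^ 2 • (1 : Matrix (Fin n) (Fin n) ℝ)).mulVec (σ⁻¹ • t).ofLp)
        = ‖t‖ ^ 2 := by
      rw [EuclideanSpace.norm_sq_eq, Matrix.smul_mulVec, Matrix.one_mulVec]
      simp only [dotProduct, Pi.smul_apply, smul_eq_mul, WithLp.ofLp_smul, Real.norm_eq_abs, sq_abs]
      refine Finset.sum_congr rfl fun i _ => ?_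
      field_simp
    rw [h2]
    simp [neg_div]
  have := (HasLaw.mk (measurable_const_smul σ⁻¹).aemeasurable key).comp h
  exact this

/-! ### A union bound for events that come in pairs -/

section UnionBound

/-- Union bound over events that coincide in pairs `i, τ i`: only half of the terms count. -/
lemma two_mul_measureReal_biUnion_le {α ι : Type*} [MeasurableSpace α] (μ : Measure α)
    [IsFiniteMeasure μ] [Fintype ι] (τ : ι → ι) (hτ : Function.Involutive τ)
    (N : Finset ι) (hN : ∀ i ∈ N, τ i ∈ N) (hne : ∀ i ∈ N, τ i ≠ i) (V : ι → Set α)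
    (hV : ∀ i, V (τ i) = V i) (g : ι → ℝ) (hg : ∀ i, g (τ i) = g i)
    (hb : ∀ i ∈ N, μ.real (V i) ≤ g i) :
    2 * μ.real (⋃ i ∈ N, V i) ≤ ∑ i ∈ N, g i := by
  classical
  let e := Fintype.equivFin ι
  set R := N.filter fun i => e i < e (τ i) with hR
  have hsum : ∑ i ∈ N.filter (fun i => ¬ e i < e (τ i)), g i = ∑ i ∈ R, g i := by
    refine Finset.sum_bij' (fun i _ => τ i) (fun i _ => τ i) ?_ ?_ ?_ ?_ ?_
    · intro i hi
      simp only [Finset.mem_filter, hR, hτ i] at hi ⊢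
      exact ⟨hN i hi.1, lt_of_le_of_ne (not_lt.1 hi.2)
        fun h => hne i hi.1 (e.injective h)⟩
    · intro i hi
      simp only [Finset.mem_filter, hR, hτ i] at hi ⊢
      exact ⟨hN i hi.1, hi.2.not_gt⟩
    · intro i _; exact hτ i
    · intro i _; exact hτ i
    · intro i _; exact (hg i).symm
  have hsub : (⋃ i ∈ N, V i) ⊆ ⋃ i ∈ R, V i := by
    intro x hx
    simp only [Set.mem_iUnion] at hx ⊢
    obtain ⟨i, hi, hxi⟩ := hx
    by_cases h : e i < e (τ i)
    · exact ⟨i, Finset.mem_filter.2 ⟨hi, h⟩, hxi⟩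
    · refine ⟨τ i, Finset.mem_filter.2 ⟨hN i hi, ?_⟩, by rwa [hV]⟩
      rw [hτ i]
      exact lt_of_le_of_ne (not_lt.1 h) fun h => hne i hi (e.injective h)
  have h1 : μ.real (⋃ i ∈ N, V i) ≤ ∑ i ∈ R, g i :=
    calc μ.real (⋃ i ∈ N, V i) ≤ μ.real (⋃ i ∈ R, V i) := measureReal_mono hsub (measure_ne_top _ _)
      _ ≤ ∑ i ∈ R, μ.real (V i) := measureReal_biUnion_finset_le _ _
      _ ≤ ∑ i ∈ R, g i := Finset.sum_le_sum fun i hi => hb i (Finset.mem_filter.1 hi).1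
  rw [← Finset.sum_filter_add_sum_filter_not N (fun i => e i < e (τ i)), hsum]
  linarith

end UnionBound

/-! ### Noise planes and the good event -/

section GoodEvent

variable {n p : ℕ}

/-- The span of the design vectors indexed by `A`. -/
abbrev colSpan (X : Matrix (Fin n) (Fin p) ℝ) (A : Finset (Fin p)) :
    Submodule ℝ (EuclideanSpace ℝ (Fin n)) :=
  Submodule.span ℝ (designVec X '' (A : Set (Fin p)))

/-- The part `(I - P_A) X β` of the mean that the model `A` does not explain. -/
noncomputable def unexplained (X : Matrix (Fin n) (Fin p) ℝ) (β : Fin p → ℝ) (A : Finset (Fin p)) :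
    EuclideanSpace ℝ (Fin n) :=
  linPred X β - (colSpan X A).starProjection (linPred X β)

/-- `w` is the vector `X_A (X_Aᵀ X_A)⁻¹ s_A`, characterised without inverting the Gram matrix: it
lies in the span of the design vectors in `A` and has inner product `s j` with each of them. -/
def IsDualVec (X : Matrix (Fin n) (Fin p) ℝ) (A : Finset (Fin p)) (s : Fin p → ℝ)
    (w : EuclideanSpace ℝ (Fin n)) : Prop :=
  w ∈ colSpan X A ∧ ∀ j ∈ A, ⟪designVec X j, w⟫ = s j

/-- Two vectors of the span with the same inner products with the spanning vectors agree. -/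
lemma IsDualVec.unique {X : Matrix (Fin n) (Fin p) ℝ} {A : Finset (Fin p)} {s : Fin p → ℝ}
    {w w' : EuclideanSpace ℝ (Fin n)} (h : IsDualVec X A s w) (h' : IsDualVec X A s w') :
    w = w' := by
  have hmem : w - w' ∈ (colSpan X A)ᗮ := by
    rw [Submodule.mem_orthogonal]
    intro u hu
    induction hu using Submodule.span_induction with
    | mem x hx =>
      obtain ⟨j, hj, rfl⟩ := hx
      rw [inner_sub_right, h.2 j hj, h'.2 j hj, sub_self]
    | zero => simp
    | add x y _ _ hx hy => rw [inner_add_left, hx, hy, add_zero]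
    | smul c x _ hx => rw [inner_smul_left, hx, mul_zero]
  have := Submodule.inner_right_of_mem_orthogonal (Submodule.sub_mem _ h.1 h'.1) hmem
  exact sub_eq_zero.1 (inner_self_eq_zero.1 this)

lemma IsDualVec.neg {X : Matrix (Fin n) (Fin p) ℝ} {A : Finset (Fin p)} {s : Fin p → ℝ}
    {w : EuclideanSpace ℝ (Fin n)} (h : IsDualVec X A s w) : IsDualVec X A (-s) (-w) :=
  ⟨Submodule.neg_mem _ h.1, fun j hj => by rw [inner_neg_right, h.2 j hj]; rfl⟩

/-- The space spanned by `X_A (X_Aᵀ X_A)⁻¹ s_A` and `(I - P_A) X β`. For every penalty level, the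
noise enters the analysis of the model `A` through one direction of this space. -/
def noisePlane (X : Matrix (Fin n) (Fin p) ℝ) (β : Fin p → ℝ) (A : Finset (Fin p))
    (s : Fin p → ℝ) : Submodule ℝ (EuclideanSpace ℝ (Fin n)) :=
  Submodule.span ℝ ({w | IsDualVec X A s w} ∪ {unexplained X β A})

lemma finrank_noisePlane_le (X : Matrix (Fin n) (Fin p) ℝ) (β : Fin p → ℝ) (A : Finset (Fin p))
    (s : Fin p → ℝ) : Module.finrank ℝ (noisePlane X β A s) ≤ 2 := by
  classical
  have hle : ∃ w, noisePlane X β A s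
      ≤ Submodule.span ℝ (({w, unexplained X β A} : Finset _) : Set (EuclideanSpace ℝ (Fin n))) := by
    by_cases h : ∃ w, IsDualVec X A s w
    · obtain ⟨w, hw⟩ := h
      refine ⟨w, Submodule.span_mono ?_⟩
      rintro u (hu | hu)
      · simp [IsDualVec.unique hu hw]
      · simp [Set.mem_singleton_iff.1 hu]
    · refine ⟨0, Submodule.span_mono ?_⟩
      rintro u (hu | hu)
      · exact absurd ⟨u, hu⟩ h
      · simp [Set.mem_singleton_iff.1 hu]
  obtain ⟨w, hw⟩ := hle
  exact (Submodule.finrank_mono hw).trans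
    ((finrank_span_finset_le_card _).trans Finset.card_le_two)

lemma noisePlane_neg (X : Matrix (Fin n) (Fin p) ℝ) (β : Fin p → ℝ) (A : Finset (Fin p))
    (s : Fin p → ℝ) : noisePlane X β A (-s) = noisePlane X β A s := by
  have key : ∀ s : Fin p → ℝ, noisePlane X β A (-s) ≤ noisePlane X β A s := by
    intro s
    refine Submodule.span_le.2 ?_
    rintro u (hu | hu)
    · have hu' : IsDualVec X A s (-u) := by simpa using IsDualVec.neg hu
      have hmem : -u ∈ noisePlane X β A s := Submodule.subset_span (Or.inl hu')
      exact neg_neg u ▸ Submodule.neg_mem _ hmem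
    · exact Submodule.subset_span (Or.inr hu)
  refine le_antisymm (key s) ?_
  simpa using key (-s)

/-- A model together with a sign in `{-1, 0, 1}` for each of its members; `none` marks the
indices outside the model. -/
abbrev SignPattern (p : ℕ) := Fin p → Option SignType

namespace SignPattern

/-- The model of a sign pattern. -/
def carrier (f : SignPattern p) : Finset (Fin p) := Finset.univ.filter fun j => (f j).isSome

/-- The signs as real numbers, `0` outside the model. -/
def val (f : SignPattern p) (j : Fin p) : ℝ := (f j).elim 0 fun s => (s : ℝ)

/-- The pattern with all signs reversed. -/
def opp (f : SignPattern p) : SignPattern p := fun j => (f j).map fun s => -s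

lemma opp_involutive : Function.Involutive (opp (p := p)) := by
  intro f
  ext1 j
  simp only [opp]
  cases f j <;> simp

lemma carrier_opp (f : SignPattern p) : (opp f).carrier = f.carrier := by
  ext j; simp [carrier, opp]

lemma val_opp (f : SignPattern p) : (opp f).val = -f.val := by
  ext j
  simp only [val, opp, Pi.neg_apply]
  cases f j with
  | none => simp
  | some s => cases s <;> simp

/-- Each index is outside the model or carries one of three signs. -/
lemma sum_pow_card (x : ℝ) :
    ∑ f : SignPattern p, x ^ f.carrier.card = (1 + 3 * x) ^ p := by
  have h : ∀ f : SignPattern p,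
      x ^ f.carrier.card = ∏ j, if (f j).isSome then x else 1 := by
    intro f
    rw [Finset.prod_ite, Finset.prod_const, Finset.prod_const_one, mul_one, carrier]
  have h3 : ∑ o : Option SignType, (if o.isSome then x else 1) = 1 + 3 * x := by
    rw [Fintype.sum_option]
    have : Fintype.card SignType = 3 := rfl
    simp [this]
  simp_rw [h]
  have := Finset.prod_univ_sum (fun _ : Fin p => (Finset.univ : Finset (Option SignType)))
    (fun _ o => if o.isSome then x else 1)
  rw [Fintype.piFinset_univ] at this
  rw [← this]
  simp only [h3, Finset.prod_const, Finset.card_univ, Fintype.card_fin]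

end SignPattern

/-- The admissible squared length `2 (1 + c₀) (m ∨ 1) log (p ∨ a)` of the projected standardised
noise, for a model of size `m`. -/
noncomputable def noiseLevel (p : ℕ) (c₀ a : ℝ) (m : ℕ) : ℝ :=
  2 * (1 + c₀) * Real.log (max (p : ℝ) a) * (max m 1 : ℕ)

/-- The values of the standardised noise whose projections on all noise planes are small. The
all-zero signs are left out unless the model is empty: a noise plane is shared by a pattern and its
opposite, and this halves the union bound only for patterns that differ from their opposites. -/
def goodEvent (X : Matrix (Fin n) (Fin p) ℝ) (β : Fin p → ℝ) (c₀ a : ℝ) :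
    Set (EuclideanSpace ℝ (Fin n)) :=
  {e | ∀ f : SignPattern p, (f.carrier = ∅ ∨ ∃ j, f.val j ≠ 0) →
    ‖(noisePlane X β f.carrier f.val).orthogonalProjectionOnto e‖ ^ 2
      ≤ noiseLevel p c₀ a f.carrier.card}

lemma measurableSet_goodEvent (X : Matrix (Fin n) (Fin p) ℝ) (β : Fin p → ℝ) (c₀ a : ℝ) :
    MeasurableSet (goodEvent X β c₀ a) := by
  have : goodEvent X β c₀ a = ⋂ f : SignPattern p, ⋂ _ : (f.carrier = ∅ ∨ ∃ j, f.val j ≠ 0),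
      {e | ‖(noisePlane X β f.carrier f.val).orthogonalProjectionOnto e‖ ^ 2
        ≤ noiseLevel p c₀ a f.carrier.card} := by
    ext e; simp [goodEvent]
  rw [this]
  exact (isClosed_iInter fun f => isClosed_iInter fun _ =>
    isClosed_le (by fun_prop) continuous_const).measurableSet

lemma exp_neg_noiseLevel {c₀ a : ℝ} (hp : 0 < p) (m : ℕ) :
    Real.exp (-noiseLevel p c₀ a m / 2) = ((max (p : ℝ) a ^ (1 + c₀))⁻¹) ^ (max m 1) := by
  have hM : 0 < max (p : ℝ) a := lt_max_of_lt_left (by exact_mod_cast hp)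
  rw [← Real.rpow_neg hM.le, Real.rpow_def_of_pos hM, ← Real.exp_nat_mul, noiseLevel]
  congr 1
  ring

lemma noiseLevel_nonneg {c₀ a : ℝ} (hp : 0 < p) (hc₀ : 0 ≤ c₀) (m : ℕ) :
    0 ≤ noiseLevel p c₀ a m := by
  have hM : 1 ≤ max (p : ℝ) a := le_max_of_le_left (by exact_mod_cast hp)
  have := Real.log_nonneg hM
  unfold noiseLevel
  positivity

lemma measureReal_goodEvent_compl_le (X : Matrix (Fin n) (Fin p) ℝ) (β : Fin p → ℝ) {c₀ a : ℝ}
    (hp : 0 < p) (hc₀ : 0 ≤ c₀) :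
    (stdGaussian (EuclideanSpace ℝ (Fin n))).real (goodEvent X β c₀ a)ᶜ
      ≤ ((1 + 3 * (max (p : ℝ) a ^ (1 + c₀))⁻¹) ^ p - 1) / 2 + (max (p : ℝ) a ^ (1 + c₀))⁻¹ := by
  classical
  set μ := stdGaussian (EuclideanSpace ℝ (Fin n))
  set x := (max (p : ℝ) a ^ (1 + c₀))⁻¹ with hx
  have hx0 : 0 ≤ x := inv_nonneg.2 (Real.rpow_nonneg (le_max_of_le_left (by positivity)) _)
  let V : SignPattern p → Set (EuclideanSpace ℝ (Fin n)) := fun f =>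
    {e | noiseLevel p c₀ a f.carrier.card
      < ‖(noisePlane X β f.carrier f.val).orthogonalProjectionOnto e‖ ^ 2}
  let N : Finset (SignPattern p) := Finset.univ.filter fun f => ∃ j, f.val j ≠ 0
  have hV : ∀ f, μ.real (V f) ≤ x ^ (max f.carrier.card 1) := by
    intro f
    have := stdGaussian_projection_tail (finrank_noisePlane_le X β f.carrier f.val)
      (noiseLevel_nonneg (a := a) hp hc₀ f.carrier.card)
    rw [exp_neg_noiseLevel hp] at this
    exact ENNReal.toReal_le_of_le_ofReal (pow_nonneg hx0 _) this
  have hcard : ∀ f ∈ N, max f.carrier.card 1 = f.carrier.card := by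
    intro f hf
    obtain ⟨j, hj⟩ := (Finset.mem_filter.1 hf).2
    refine max_eq_left (Finset.card_pos.2 ⟨j, ?_⟩)
    simp only [SignPattern.carrier, Finset.mem_filter, Finset.mem_univ, true_and]
    by_contra h
    exact hj (by simp [SignPattern.val, Option.not_isSome_iff_eq_none.1 h])
  have h2 : 2 * μ.real (⋃ f ∈ N, V f) ≤ ∑ f ∈ N, x ^ f.carrier.card := by
    refine two_mul_measureReal_biUnion_le μ SignPattern.opp SignPattern.opp_involutive N ?_ ?_ V ?_
      _ ?_ ?_
    · intro f hf
      obtain ⟨j, hj⟩ := (Finset.mem_filter.1 hf).2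
      exact Finset.mem_filter.2 ⟨Finset.mem_univ _, j, by simpa [SignPattern.val_opp] using hj⟩
    · intro f hf h
      obtain ⟨j, hj⟩ := (Finset.mem_filter.1 hf).2
      have := congrFun (SignPattern.val_opp f) j
      rw [h, Pi.neg_apply] at this
      exact hj (by linarith)
    · intro f
      simp only [V]
      rw [SignPattern.carrier_opp, SignPattern.val_opp, noisePlane_neg]
    · intro f; simp only [SignPattern.carrier_opp]
    · intro f hf
      simpa [hcard f hf] using hV f
  have h3 : ∑ f ∈ N, x ^ f.carrier.card ≤ (1 + 3 * x) ^ p - 1 := by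
    have hz : (fun _ => none : SignPattern p) ∉ N := by
      intro h
      obtain ⟨j, hj⟩ := (Finset.mem_filter.1 h).2
      exact hj rfl
    have := Finset.sum_le_univ_sum_of_nonneg (s := insert (fun _ => none : SignPattern p) N)
      (f := fun f => x ^ f.carrier.card) (fun f => pow_nonneg hx0 _)
    rw [SignPattern.sum_pow_card, Finset.sum_insert hz] at this
    have h0 : (SignPattern.carrier (fun _ => none : SignPattern p)) = ∅ := by
      simp [SignPattern.carrier]
    rw [h0] at this
    simp only [Finset.card_empty, pow_zero] at this
    linarith
  have hsub : (goodEvent X β c₀ a)ᶜ ⊆ (⋃ f ∈ N, V f) ∪ V (fun _ => none) := by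
    intro e he
    simp only [goodEvent, Set.mem_compl_iff, Set.mem_ofPred_eq, not_forall, not_le] at he
    obtain ⟨f, hf, he⟩ := he
    rcases hf with hf | hf
    · right
      have : f = fun _ => none := by
        ext1 j
        have : j ∉ f.carrier := by simp [hf]
        simpa [SignPattern.carrier] using this
      rw [← this]; exact he
    · left
      exact Set.mem_biUnion (Finset.mem_coe.2 (Finset.mem_filter.2 ⟨Finset.mem_univ f, hf⟩)) he
  have h4 := hV (fun _ => none)
  have h0 : (SignPattern.carrier (fun _ => none : SignPattern p)) = ∅ := by
    simp [SignPattern.carrier]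
  rw [h0] at h4
  simp only [Finset.card_empty, zero_le, max_eq_right, pow_one] at h4
  calc μ.real (goodEvent X β c₀ a)ᶜ ≤ μ.real ((⋃ f ∈ N, V f) ∪ V (fun _ => none)) :=
        measureReal_mono hsub
    _ ≤ μ.real (⋃ f ∈ N, V f) + μ.real (V fun _ => none) := measureReal_union_le _ _
    _ ≤ _ := by linarith

/-- Unless the asserted lower bound on the probability is trivial, `y = exp (p x)` is below `√2`, and then the
three-sign count fits: `(y³ - 1) / 2 ≤ y² - 1`. -/
lemma three_sign_count_le {x : ℝ} (hx : 0 ≤ x) :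
    min 1 (((1 + 3 * x) ^ p - 1) / 2 + x) ≤ Real.exp (2 * (p * x)) - 1 + 2 * x := by
  by_cases h : 2 ≤ Real.exp (2 * (p * x))
  · exact (min_le_left _ _).trans (by linarith)
  · refine (min_le_right _ _).trans ?_
    set y := Real.exp (p * x) with hy
    have hy1 : 1 ≤ y := Real.one_le_exp (by positivity)
    have hy2 : Real.exp (2 * (p * x)) = y ^ 2 := by rw [hy, ← Real.exp_nat_mul]; norm_num
    have hy3 : (1 + 3 * x) ^ p ≤ y ^ 3 := by
      calc (1 + 3 * x) ^ p ≤ Real.exp (3 * x) ^ p :=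
            pow_le_pow_left₀ (by positivity) (by linarith [Real.add_one_le_exp (3 * x)]) _
        _ = y ^ 3 := by rw [hy, ← Real.exp_nat_mul, ← Real.exp_nat_mul]; congr 1; push_cast; ring
    rw [hy2] at h ⊢
    have hylt : y < 3 / 2 := by nlinarith
    nlinarith [mul_nonneg (sub_nonneg.2 hy1) (by nlinarith : 0 ≤ 1 + y - y ^ 2)]

lemma goodEvent_prob (X : Matrix (Fin n) (Fin p) ℝ) (β : Fin p → ℝ) {c₀ a : ℝ}
    (hp : 0 < p) (hc₀ : 0 ≤ c₀) :
    2 - Real.exp (2 * p / (max (p : ℝ) a) ^ (1 + c₀)) - 2 / (max (p : ℝ) a) ^ (1 + c₀)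
      ≤ (stdGaussian (EuclideanSpace ℝ (Fin n))).real (goodEvent X β c₀ a) := by
  have h1 := measureReal_goodEvent_compl_le X β (a := a) hp hc₀
  have hc := probReal_compl_eq_one_sub (μ := stdGaussian (EuclideanSpace ℝ (Fin n)))
    (measurableSet_goodEvent X β c₀ a)
  have h0 : 0 ≤ (stdGaussian (EuclideanSpace ℝ (Fin n))).real (goodEvent X β c₀ a) :=
    measureReal_nonneg
  have hx0 : 0 ≤ (max (p : ℝ) a ^ (1 + c₀))⁻¹ :=
    inv_nonneg.2 (Real.rpow_nonneg (le_max_of_le_left (by positivity)) _)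
  have h2 := three_sign_count_le (p := p) hx0
  have h3 := le_min (show _ ≤ (1 : ℝ) by linarith) h1
  rw [div_eq_mul_inv, div_eq_mul_inv, mul_assoc]
  linarith

/-- On the good event the noise correlates weakly with every vector of a noise plane. -/
lemma inner_sq_le_of_mem_goodEvent {X : Matrix (Fin n) (Fin p) ℝ} {β : Fin p → ℝ} {c₀ a : ℝ}
    {e : EuclideanSpace ℝ (Fin n)} (he : e ∈ goodEvent X β c₀ a) {A : Finset (Fin p)}
    {s : Fin p → ℝ} (hs : ∀ j ∈ A, s j = -1 ∨ s j = 0 ∨ s j = 1)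
    (hA : A = ∅ ∨ ∃ j ∈ A, s j ≠ 0) {u : EuclideanSpace ℝ (Fin n)}
    (hu : u ∈ noisePlane X β A s) :
    ⟪e, u⟫ ^ 2 ≤ noiseLevel p c₀ a A.card * ‖u‖ ^ 2 := by
  classical
  let f : SignPattern p := fun j => if j ∈ A then some (SignType.sign (s j)) else none
  have hc : f.carrier = A := by
    ext j
    by_cases h : j ∈ A <;> simp [SignPattern.carrier, f, h]
  have hv : ∀ j ∈ A, f.val j = s j := by
    intro j hj
    rcases hs j hj with h | h | h <;> simp [SignPattern.val, f, hj, h]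
  have hplane : noisePlane X β f.carrier f.val = noisePlane X β A s := by
    have : ∀ w, IsDualVec X A f.val w ↔ IsDualVec X A s w := fun w =>
      and_congr_right fun _ => forall₂_congr fun j hj => by rw [hv j hj]
    rw [hc, noisePlane, noisePlane]
    simp only [this]
  have h := he f (hA.imp (fun h => hc.trans h) fun ⟨j, hj, h⟩ => ⟨j, by rwa [hv j hj]⟩)
  rw [show f.carrier.card = A.card by rw [hc]] at h
  rw [← hplane] at hu
  set W := noisePlane X β f.carrier f.val
  have h2 : ⟪e, u⟫ = ⟪W.orthogonalProjectionOnto e, (⟨u, hu⟩ : W)⟫ := by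
    rw [Submodule.inner_orthogonalProjectionOnto_eq_of_mem_right]
  rw [h2]
  calc _ ≤ (‖W.orthogonalProjectionOnto e‖ * ‖u‖) ^ 2 := by
        rw [← sq_abs]
        exact pow_le_pow_left₀ (abs_nonneg _) (abs_real_inner_le_norm _ (⟨u, hu⟩ : W)) 2
    _ ≤ _ := by rw [mul_pow]; gcongr

end GoodEvent

/-! ### Karush–Kuhn–Tucker conditions and the LASSO path -/

section Lasso

variable {n p : ℕ}

lemma linPred_add (X : Matrix (Fin n) (Fin p) ℝ) (b b' : Fin p → ℝ) :
    linPred X (b + b') = linPred X b + linPred X b' := by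
  simp [linPred, add_smul, Finset.sum_add_distrib]

lemma linPred_sub (X : Matrix (Fin n) (Fin p) ℝ) (b b' : Fin p → ℝ) :
    linPred X (b - b') = linPred X b - linPred X b' := by
  simp [linPred, sub_smul, Finset.sum_sub_distrib]

lemma inner_linPred (X : Matrix (Fin n) (Fin p) ℝ) (b : Fin p → ℝ)
    (u : EuclideanSpace ℝ (Fin n)) :
    ⟪linPred X b, u⟫ = ∑ j, b j * ⟪designVec X j, u⟫ := by
  simp [linPred, sum_inner, real_inner_smul_left]

@[fun_prop]
lemma continuous_linPred (X : Matrix (Fin n) (Fin p) ℝ) : Continuous (linPred X) := by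
  unfold linPred; fun_prop

lemma nonneg_of_forall_add_mul_nonneg {c d : ℝ} (h : ∀ t, 0 < t → t < 1 → 0 ≤ c + t * d) :
    0 ≤ c := by
  by_contra hc
  push Not at hc
  have hd : 0 < |d| + 1 := by positivity
  set t := min (1 / 2) (-c / (2 * (|d| + 1))) with ht
  have ht0 : 0 < t := lt_min (by norm_num) (by apply div_pos <;> linarith)
  have ht1 : t < 1 := (min_le_left _ _).trans_lt (by norm_num)
  have ht2 : t * (2 * (|d| + 1)) ≤ -c := by
    rw [← le_div_iff₀ (by positivity)]; exact min_le_right _ _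
  have := h t ht0 ht1
  nlinarith [le_abs_self d]

/-- The Karush–Kuhn–Tucker conditions for the LASSO criterion: every design vector has correlation
at most `l` with the residual, with equality and matching sign at the nonzero coefficients. -/
def IsKKT (X : Matrix (Fin n) (Fin p) ℝ) (y : EuclideanSpace ℝ (Fin n)) (l : ℝ)
    (b : Fin p → ℝ) : Prop :=
  ∀ j, |⟪designVec X j, y - linPred X b⟫| ≤ l ∧
    b j * ⟪designVec X j, y - linPred X b⟫ = l * |b j|

lemma lassoObj_add_single (X : Matrix (Fin n) (Fin p) ℝ) (y : EuclideanSpace ℝ (Fin n)) (l : ℝ)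
    (b : Fin p → ℝ) (j : Fin p) (t : ℝ) :
    lassoObj X y l (b + Pi.single j t) = lassoObj X y l b
      - t * ⟪designVec X j, y - linPred X b⟫ + t ^ 2 * ‖designVec X j‖ ^ 2 / 2
      + l * (|b j + t| - |b j|) := by
  have h1 : linPred X (Pi.single j t) = t • designVec X j := by
    rw [linPred, Finset.sum_eq_single j] <;> simp +contextual
  have h2 : ∑ i, |(b + Pi.single j t : Fin p → ℝ) i| = ∑ i, |b i| + (|b j + t| - |b j|) := by
    rw [← Finset.add_sum_erase _ _ (Finset.mem_univ j),
      ← Finset.add_sum_erase _ (fun i => |b i|) (Finset.mem_univ j)]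
    have : ∑ i ∈ Finset.univ.erase j, |(b + Pi.single j t : Fin p → ℝ) i| = ∑ i ∈ Finset.univ.erase j, |b i| :=
      Finset.sum_congr rfl fun i hi => by simp [Finset.ne_of_mem_erase hi]
    rw [this]
    simp
    ring
  rw [lassoObj, lassoObj, h2, linPred_add, h1, ← sub_sub,
    norm_sub_sq_real (y - linPred X b) (t • designVec X j), real_inner_smul_right, norm_smul,
    real_inner_comm, mul_pow, Real.norm_eq_abs, sq_abs]
  ring

lemma LassoRate.IsLasso.isKKT {X : Matrix (Fin n) (Fin p) ℝ} {y : EuclideanSpace ℝ (Fin n)} {l : ℝ}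
    {b : Fin p → ℝ} (hl : 0 ≤ l) (h : IsLasso X y l b) : IsKKT X y l b := by
  intro j
  set g := ⟪designVec X j, y - linPred X b⟫ with hg
  set K := ‖designVec X j‖ ^ 2 with hK
  have key : ∀ t, 0 ≤ - t * g + t ^ 2 * K / 2 + l * (|b j + t| - |b j|) := by
    intro t
    have := h (b + Pi.single j t)
    rw [lassoObj_add_single] at this
    linarith
  have hle : |g| ≤ l := by
    rw [abs_le']
    constructor
    · have : 0 ≤ l - g := by
        refine nonneg_of_forall_add_mul_nonneg (d := K / 2) fun t ht0 _ => ?_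
        have h1 := key t
        have h2 : |b j + t| - |b j| ≤ t := by
          have := abs_add_le (b j) t
          rw [abs_of_pos ht0] at this; linarith
        have h3 := mul_le_mul_of_nonneg_left h2 hl
        have : 0 ≤ t * (l - g + t * (K / 2)) := by nlinarith
        exact nonneg_of_mul_nonneg_right this ht0
      linarith
    · have : 0 ≤ l + g := by
        refine nonneg_of_forall_add_mul_nonneg (d := K / 2) fun t ht0 _ => ?_
        have h1 := key (-t)
        have h2 : |b j + -t| - |b j| ≤ t := by
          have := abs_add_le (b j) (-t)
          rw [abs_neg, abs_of_pos ht0] at this; linarith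
        have h3 := mul_le_mul_of_nonneg_left h2 hl
        have : 0 ≤ t * (l + g + t * (K / 2)) := by nlinarith
        exact nonneg_of_mul_nonneg_right this ht0
      linarith
  refine ⟨hle, le_antisymm ?_ ?_⟩
  · calc b j * g ≤ |b j * g| := le_abs_self _
      _ = |b j| * |g| := abs_mul _ _
      _ ≤ |b j| * l := by gcongr
      _ = l * |b j| := mul_comm _ _
  · have : 0 ≤ b j * g - l * |b j| := by
      refine nonneg_of_forall_add_mul_nonneg (d := b j ^ 2 * K / 2) fun t ht0 ht1 => ?_
      have h1 := key (-t * b j)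
      have h2 : |b j + -t * b j| = (1 - t) * |b j| := by
        rw [show b j + -t * b j = (1 - t) * b j by ring, abs_mul, abs_of_pos (by linarith)]
      rw [h2] at h1
      have : 0 ≤ t * (b j * g - l * |b j| + t * (b j ^ 2 * K / 2)) := by nlinarith
      exact nonneg_of_mul_nonneg_right this ht0
    linarith

lemma norm_le_sum_abs (b : Fin p → ℝ) : ‖b‖ ≤ ∑ j, |b j| := by
  refine (pi_norm_le_iff_of_nonneg (Finset.sum_nonneg fun j _ => abs_nonneg _)).2 fun j => ?_
  exact Finset.single_le_sum (f := fun j => |b j|) (fun j _ => abs_nonneg _) (Finset.mem_univ j)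

lemma exists_isLasso (X : Matrix (Fin n) (Fin p) ℝ) (y : EuclideanSpace ℝ (Fin n)) {l : ℝ}
    (hl : 0 < l) : ∃ b, IsLasso X y l b := by
  have hc : Continuous (lassoObj X y l) := by unfold lassoObj; fun_prop
  refine hc.exists_forall_le ?_
  refine Filter.tendsto_atTop_mono (f := fun b => l * ‖b‖) (fun b => ?_)
    ((tendsto_norm_cocompact_atTop).const_mul_atTop hl)
  have := mul_le_mul_of_nonneg_left (norm_le_sum_abs b) hl.le
  unfold lassoObj
  nlinarith [sq_nonneg ‖y - linPred X b‖]

/-- All solutions at one penalty level have the same fitted values. -/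
lemma IsKKT.linPred_eq {X : Matrix (Fin n) (Fin p) ℝ} {y : EuclideanSpace ℝ (Fin n)} {l : ℝ}
    {b b' : Fin p → ℝ} (h : IsKKT X y l b) (h' : IsKKT X y l b') :
    linPred X b = linPred X b' := by
  have h1 : 0 ≤ ⟪linPred X (b - b'), (y - linPred X b) - (y - linPred X b')⟫ := by
    rw [inner_linPred]
    refine Finset.sum_nonneg fun j _ => ?_
    rw [inner_sub_right, Pi.sub_apply]
    have e1 : b j * ⟪designVec X j, y - linPred X b'⟫ ≤ l * |b j| := by
      calc _ ≤ |b j * ⟪designVec X j, y - linPred X b'⟫| := le_abs_self _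
        _ = |b j| * |⟪designVec X j, y - linPred X b'⟫| := abs_mul _ _
        _ ≤ |b j| * l := by gcongr; exact (h' j).1
        _ = _ := mul_comm _ _
    have e2 : b' j * ⟪designVec X j, y - linPred X b⟫ ≤ l * |b' j| := by
      calc _ ≤ |b' j * ⟪designVec X j, y - linPred X b⟫| := le_abs_self _
        _ = |b' j| * |⟪designVec X j, y - linPred X b⟫| := abs_mul _ _
        _ ≤ |b' j| * l := by gcongr; exact (h j).1
        _ = _ := mul_comm _ _
    have e3 := (h j).2
    have e4 := (h' j).2
    nlinarith
  rw [sub_sub_sub_cancel_left, ← linPred_sub, show linPred X (b' - b) = - linPred X (b - b') by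
    rw [linPred_sub, linPred_sub, neg_sub], inner_neg_right, real_inner_self_eq_norm_sq] at h1
  have h2 : ‖linPred X (b - b')‖ = 0 := by
    have := sq_nonneg ‖linPred X (b - b')‖
    exact pow_eq_zero_iff two_ne_zero |>.1 (by linarith)
  rw [linPred_sub] at h2
  exact sub_eq_zero.1 (norm_eq_zero.1 h2)

lemma IsKKT.sum_abs_le {X : Matrix (Fin n) (Fin p) ℝ} {y : EuclideanSpace ℝ (Fin n)} {l : ℝ}
    {b : Fin p → ℝ} (h : IsKKT X y l b) : l * ∑ j, |b j| ≤ ‖y‖ ^ 2 := by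
  have h1 : l * ∑ j, |b j| = ⟪linPred X b, y - linPred X b⟫ := by
    rw [inner_linPred, Finset.mul_sum]
    exact Finset.sum_congr rfl fun j _ => (h j).2.symm
  rw [h1, inner_sub_right, real_inner_self_eq_norm_sq]
  nlinarith [real_inner_le_norm (linPred X b) y, sq_nonneg (‖linPred X b‖ - ‖y‖), sq_nonneg ‖y‖,
    sq_nonneg ‖linPred X b‖]

/-- The equicorrelation set: the indices whose design vector has the maximal correlation `l` with
the residual. -/
noncomputable def equiSet (X : Matrix (Fin n) (Fin p) ℝ) (y : EuclideanSpace ℝ (Fin n)) (l : ℝ)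
    (b : Fin p → ℝ) : Finset (Fin p) :=
  Finset.univ.filter fun j => |⟪designVec X j, y - linPred X b⟫| = l

lemma IsKKT.selected_subset {X : Matrix (Fin n) (Fin p) ℝ} {y : EuclideanSpace ℝ (Fin n)}
    {l : ℝ} {b : Fin p → ℝ} (hl : 0 ≤ l) (h : IsKKT X y l b) : selected b ⊆ equiSet X y l b := by
  intro j hj
  have hj : b j ≠ 0 := (Finset.mem_filter.1 hj).2
  refine Finset.mem_filter.2 ⟨Finset.mem_univ _, ?_⟩
  have h2 := congrArg abs (h j).2
  rw [abs_mul, abs_mul, abs_abs, abs_of_nonneg hl, mul_comm] at h2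
  exact mul_right_cancel₀ (abs_ne_zero.2 hj) h2

lemma isClosed_exists_mem_of_isCompact {α γ : Type*} [TopologicalSpace α] [TopologicalSpace γ]
    {K : Set γ} (hK : IsCompact K) {S : Set (α × γ)} (hS : IsClosed S) :
    IsClosed {x | ∃ z ∈ K, (x, z) ∈ S} := by
  have := isCompact_iff_compactSpace.1 hK
  have h1 : IsClosed ((fun z : α × K => (z.1, (z.2 : γ))) ⁻¹' S) :=
    hS.preimage (by fun_prop)
  convert isClosedMap_fst_of_compactSpace _ h1 using 1
  ext x
  simp

lemma isClosed_isKKT (X : Matrix (Fin n) (Fin p) ℝ) (y : EuclideanSpace ℝ (Fin n)) :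
    IsClosed {z : ℝ × (Fin p → ℝ) | IsKKT X y z.1 z.2} := by
  simp only [IsKKT, Set.ofPred_forall, Set.ofPred_and]
  refine isClosed_iInter fun j => ?_
  exact (isClosed_le (by fun_prop) (by fun_prop)).inter (isClosed_eq (by fun_prop) (by fun_prop))

lemma isClosed_le_card_equiSet (X : Matrix (Fin n) (Fin p) ℝ) (y : EuclideanSpace ℝ (Fin n))
    (D : Finset (Fin p)) (N : ℕ) :
    IsClosed {z : ℝ × (Fin p → ℝ) | N ≤ (equiSet X y z.1 z.2 ∪ D).card} := by
  have : {z : ℝ × (Fin p → ℝ) | N ≤ (equiSet X y z.1 z.2 ∪ D).card}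
      = ⋃ A ∈ {A : Finset (Fin p) | N ≤ (A ∪ D).card}, ⋂ j ∈ A,
        {z : ℝ × (Fin p → ℝ) | |⟪designVec X j, y - linPred X z.2⟫| = z.1} := by
    ext z
    simp only [Set.mem_iUnion, Set.mem_iInter, Set.mem_ofPred_eq, exists_prop]
    constructor
    · intro h
      exact ⟨_, h, fun j hj => (Finset.mem_filter.1 hj).2⟩
    · rintro ⟨A, hA, h⟩
      refine hA.trans (Finset.card_le_card (Finset.union_subset_union_left fun j hj => ?_))
      exact Finset.mem_filter.2 ⟨Finset.mem_univ _, h j hj⟩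
  rw [this]
  refine Set.Finite.isClosed_biUnion (Set.toFinite _) fun A _ => isClosed_biInter fun j _ => ?_
  exact isClosed_eq (by fun_prop) (by fun_prop)

lemma isClosed_card_selected_le (D : Finset (Fin p)) (N : ℕ) :
    IsClosed {z : ℝ × (Fin p → ℝ) | (selected z.2 ∪ D).card ≤ N} := by
  have : {z : ℝ × (Fin p → ℝ) | (selected z.2 ∪ D).card ≤ N}
      = ⋃ A ∈ {A : Finset (Fin p) | (A ∪ D).card ≤ N}, ⋂ j ∈ Aᶜ,
        {z : ℝ × (Fin p → ℝ) | z.2 j = 0} := by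
    ext z
    simp only [Set.mem_iUnion, Set.mem_iInter, Set.mem_ofPred_eq, exists_prop]
    constructor
    · intro h
      exact ⟨_, h, fun j hj => by simpa [selected] using hj⟩
    · rintro ⟨A, hA, h⟩
      refine le_trans (Finset.card_le_card (Finset.union_subset_union_left fun j hj => ?_)) hA
      by_contra hjA
      exact (Finset.mem_filter.1 hj).2 (h j (Finset.mem_compl.2 hjA))
  rw [this]
  refine Set.Finite.isClosed_biUnion (Set.toFinite _) fun A _ => isClosed_biInter fun j _ => ?_
  exact isClosed_eq (by fun_prop) (by fun_prop)

/-- A continuity argument along the LASSO path. Suppose that at all penalty levels from `l₀` on, a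
model between the selected set and the equicorrelation set (both enlarged by `D`) has strictly
fewer than `N` members as soon as it has at most `N`. Then fewer than `N` indices are selected or in
`D` at level `l₀`. The levels with a solution selecting at most `N` and the levels with
equicorrelation set of size at least `N` are closed, disjoint and cover `[l₀, ∞)`; the former
contain all large levels. -/
lemma card_selected_union_lt {X : Matrix (Fin n) (Fin p) ℝ} {y : EuclideanSpace ℝ (Fin n)}
    {l₀ : ℝ} (hl₀ : 0 < l₀) {D : Finset (Fin p)} {N : ℕ} (hD : D.card ≤ N)
    (H : ∀ l, l₀ ≤ l → ∀ b, IsKKT X y l b → ∀ A : Finset (Fin p), selected b ∪ D ⊆ A →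
      A ⊆ equiSet X y l b ∪ D → A.card ≤ N → A.card < N)
    {b : Fin p → ℝ} (hb : IsKKT X y l₀ b) : (selected b ∪ D).card < N := by
  set K : Set (Fin p → ℝ) := Metric.closedBall 0 (‖y‖ ^ 2 / l₀) with hK
  have hKmem : ∀ l, l₀ ≤ l → ∀ b, IsKKT X y l b → b ∈ K := by
    intro l hl b hb
    rw [hK, mem_closedBall_zero_iff, le_div_iff₀ hl₀]
    have h1 := hb.sum_abs_le
    have h2 := norm_le_sum_abs b
    nlinarith [norm_nonneg b]
  have hKc : IsCompact K := isCompact_closedBall _ _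
  set T₁ : Set ℝ := {l | ∃ b ∈ K, (l, b) ∈ {z : ℝ × (Fin p → ℝ) | IsKKT X y z.1 z.2} ∩
    {z : ℝ × (Fin p → ℝ) | N ≤ (equiSet X y z.1 z.2 ∪ D).card}} with hT₁
  set T₂ : Set ℝ := {l | ∃ b ∈ K, (l, b) ∈ {z : ℝ × (Fin p → ℝ) | IsKKT X y z.1 z.2} ∩
    {z : ℝ × (Fin p → ℝ) | (selected z.2 ∪ D).card ≤ N}} with hT₂
  have hT₁c : IsClosed T₁ := isClosed_exists_mem_of_isCompact hKc
    ((isClosed_isKKT X y).inter (isClosed_le_card_equiSet X y D N))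
  have hT₂c : IsClosed T₂ := isClosed_exists_mem_of_isCompact hKc
    ((isClosed_isKKT X y).inter (isClosed_card_selected_le D N))
  have hcover : Set.Ici l₀ ⊆ T₁ ∪ T₂ := by
    intro l hl
    obtain ⟨b, hb⟩ := exists_isLasso X y (hl₀.trans_le hl)
    have hb := hb.isKKT (hl₀.le.trans hl)
    by_cases h : N ≤ (equiSet X y l b ∪ D).card
    · exact Or.inl ⟨b, hKmem l hl b hb, hb, h⟩
    · refine Or.inr ⟨b, hKmem l hl b hb, hb, ?_⟩
      exact (Finset.card_le_card (Finset.union_subset_union_left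
        (hb.selected_subset (hl₀.le.trans hl)))).trans (not_le.1 h).le
  have hdisj : ¬ (Set.Ici l₀ ∩ (T₁ ∩ T₂)).Nonempty := by
    rintro ⟨l, hl, ⟨b₁, _, hb₁, hN₁⟩, ⟨b₂, _, hb₂, hN₂⟩⟩
    simp only [Set.mem_ofPred_eq] at hb₁ hN₁ hb₂ hN₂
    have he : equiSet X y l b₁ = equiSet X y l b₂ := by
      rw [equiSet, equiSet, hb₁.linPred_eq hb₂]
    rw [he] at hN₁
    obtain ⟨A, hA₁, hA₂, hA⟩ := Finset.exists_subsuperset_card_eq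
      (Finset.union_subset_union_left (t := D) (hb₂.selected_subset (hl₀.le.trans hl))) hN₂ hN₁
    exact (H l hl b₂ hb₂ A hA₁ hA₂ hA.le).ne hA
  have hne : (Set.Ici l₀ ∩ T₂).Nonempty := by
    set l := max l₀ (∑ j, |⟪designVec X j, y⟫|)
    have h0 : linPred X 0 = 0 := by simp [linPred]
    have hkkt : IsKKT X y l 0 := by
      intro j
      refine ⟨?_, by simp⟩
      rw [h0, sub_zero]
      exact (Finset.single_le_sum (f := fun j => |⟪designVec X j, y⟫|) (fun j _ => abs_nonneg _)
        (Finset.mem_univ j)).trans (le_max_right _ _)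
    refine ⟨l, Set.mem_Ici.2 (le_max_left _ _), 0, hKmem l (le_max_left _ _) 0 hkkt, hkkt, ?_⟩
    simpa [selected] using hD
  have hempty : ¬ (Set.Ici l₀ ∩ T₁).Nonempty := fun h =>
    hdisj (isPreconnected_closed_iff.1 isPreconnected_Ici T₁ T₂ hT₁c hT₂c hcover h hne)
  refine lt_of_le_of_lt (Finset.card_le_card (Finset.union_subset_union_left
    (hb.selected_subset hl₀.le))) (not_le.1 fun h => hempty ?_)
  exact ⟨l₀, Set.mem_Ici.2 le_rfl, b, hKmem l₀ le_rfl b hb, hb, h⟩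

end Lasso

/-! ### Consequences of the sparse Riesz condition -/

section Riesz

variable {n p : ℕ}

lemma LassoRate.SparseRiesz.bounds (hn : 0 < n) {X : Matrix (Fin n) (Fin p) ℝ} {qs : ℕ} {cl cu : ℝ}
    (h : SparseRiesz X qs cl cu) {A : Finset (Fin p)} (hA : A.card ≤ qs) {v : Fin p → ℝ}
    (hv : ∀ j ∉ A, v j = 0) :
    cl * n * ∑ j, v j ^ 2 ≤ ‖linPred X v‖ ^ 2 ∧ ‖linPred X v‖ ^ 2 ≤ cu * n * ∑ j, v j ^ 2 := by
  obtain ⟨hqs, -, -, h⟩ := h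
  by_cases hv0 : v = 0
  · subst hv0; simp [linPred]
  obtain ⟨B, hAB, -, hB⟩ := Finset.exists_subsuperset_card_eq (Finset.subset_univ A) hA
    (by simpa using hqs)
  have hvB : ∀ j ∉ B, v j = 0 := fun j hj => hv j fun hjA => hj (hAB hjA)
  set w : EuclideanSpace ℝ B := WithLp.toLp 2 fun j => v j with hw
  have hlin : ∑ j : B, w j • designVec X j = linPred X v := by
    rw [linPred, Finset.sum_coe_sort B (fun j => v j • designVec X j)]
    refine Finset.sum_subset (Finset.subset_univ B) fun j _ hj => by simp [hvB j hj]
  have hsq : ‖w‖ ^ 2 = ∑ j, v j ^ 2 := by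
    rw [EuclideanSpace.norm_sq_eq]
    simp only [hw, Real.norm_eq_abs, sq_abs]
    rw [Finset.sum_coe_sort B (fun j => v j ^ 2)]
    refine Finset.sum_subset (Finset.subset_univ B) fun j _ hj => by simp [hvB j hj]
  have hw0 : w ≠ 0 := by
    intro hw0
    refine hv0 (funext fun j => ?_)
    by_cases hj : j ∈ B
    · exact congrFun (congrArg WithLp.ofLp hw0) ⟨j, hj⟩
    · exact hvB j hj
  have hpos : 0 < (n : ℝ) * ‖w‖ ^ 2 := by
    have : 0 < ‖w‖ := norm_pos_iff.2 hw0
    positivity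
  have := h B hB w hw0
  rw [hlin, le_div_iff₀ hpos, div_le_iff₀ hpos, hsq] at this
  rw [mul_assoc, mul_assoc]
  exact this

lemma mem_colSpan_iff {X : Matrix (Fin n) (Fin p) ℝ} {A : Finset (Fin p)}
    {w : EuclideanSpace ℝ (Fin n)} :
    w ∈ colSpan X A ↔ ∃ v : Fin p → ℝ, (∀ j ∉ A, v j = 0) ∧ linPred X v = w := by
  constructor
  · intro hw
    induction hw using Submodule.span_induction with
    | mem x hx =>
      obtain ⟨j, hj, rfl⟩ := hx
      refine ⟨Pi.single j 1, fun i hi => ?_, ?_⟩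
      · have : i ≠ j := fun h => hi (h ▸ hj)
        simp [this]
      · rw [linPred, Finset.sum_eq_single j] <;> simp +contextual
    | zero => exact ⟨0, by simp, by simp [linPred]⟩
    | add x y _ _ hx hy =>
      obtain ⟨v, hv, rfl⟩ := hx
      obtain ⟨v', hv', rfl⟩ := hy
      exact ⟨v + v', fun j hj => by simp [hv j hj, hv' j hj], linPred_add X v v'⟩
    | smul c x _ hx =>
      obtain ⟨v, hv, rfl⟩ := hx
      refine ⟨c • v, fun j hj => by simp [hv j hj], ?_⟩
      simp [linPred, Finset.smul_sum, smul_smul]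
  · rintro ⟨v, hv, rfl⟩
    refine Submodule.sum_mem _ fun j _ => ?_
    by_cases hj : j ∈ A
    · exact Submodule.smul_mem _ _ (Submodule.subset_span ⟨j, hj, rfl⟩)
    · simp [hv j hj]

lemma exists_isDualVec (hn : 0 < n) {X : Matrix (Fin n) (Fin p) ℝ} {qs : ℕ} {cl cu : ℝ}
    (h : SparseRiesz X qs cl cu) {A : Finset (Fin p)} (hA : A.card ≤ qs) (s : Fin p → ℝ) :
    ∃ w, IsDualVec X A s w := by
  let ext : (A → ℝ) →ₗ[ℝ] (Fin p → ℝ) :=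
    { toFun := fun v j => if hj : j ∈ A then v ⟨j, hj⟩ else 0
      map_add' := fun u v => by ext j; by_cases hj : j ∈ A <;> simp [hj]
      map_smul' := fun c v => by ext j; by_cases hj : j ∈ A <;> simp [hj] }
  have hext : ∀ v, ∀ j ∉ A, ext v j = 0 := fun v j hj => by simp [ext, hj]
  have hext' : ∀ (v : A → ℝ) (j : A), ext v j = v j := fun v j => by simp [ext]
  let G : (A → ℝ) →ₗ[ℝ] (A → ℝ) :=
    { toFun := fun v j => ⟪designVec X j, linPred X (ext v)⟫
      map_add' := fun u v => by ext j; simp [linPred_add, inner_add_right]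
      map_smul' := fun c v => by
        ext j
        have : linPred X (c • ext v) = c • linPred X (ext v) := by
          simp [linPred, Finset.smul_sum, smul_smul]
        simp [this, inner_smul_right] }
  have hinj : Function.Injective G := by
    rw [← LinearMap.ker_eq_bot, LinearMap.ker_eq_bot']
    intro v hv
    have h0 : ‖linPred X (ext v)‖ ^ 2 = 0 := by
      rw [← real_inner_self_eq_norm_sq, inner_linPred]
      refine Finset.sum_eq_zero fun j _ => ?_
      by_cases hj : j ∈ A
      · rw [show ⟪designVec X j, linPred X (ext v)⟫ = 0 from congrFun hv ⟨j, hj⟩, mul_zero]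
      · rw [hext v j hj, zero_mul]
    have h1 := (h.bounds hn hA (hext v)).1
    rw [h0] at h1
    have hcl : 0 < cl * n := mul_pos h.2.1 (by exact_mod_cast hn)
    have h2 : ∑ j, ext v j ^ 2 ≤ 0 := nonpos_of_mul_nonpos_right h1 hcl
    have h3 := (Finset.sum_eq_zero_iff_of_nonneg fun j _ => sq_nonneg (ext v j)).1
      (le_antisymm h2 (Finset.sum_nonneg fun j _ => sq_nonneg _))
    ext j
    have := h3 j (Finset.mem_univ _)
    rw [hext'] at this
    simpa using this
  obtain ⟨v, hv⟩ := LinearMap.injective_iff_surjective.1 hinj fun j => s j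
  exact ⟨linPred X (ext v), mem_colSpan_iff.2 ⟨_, hext v, rfl⟩, fun j hj => congrFun hv ⟨j, hj⟩⟩

lemma IsDualVec.norm_sq_bounds (hn : 0 < n) {X : Matrix (Fin n) (Fin p) ℝ} {qs : ℕ} {cl cu : ℝ}
    (h : SparseRiesz X qs cl cu) {A : Finset (Fin p)} (hA : A.card ≤ qs) {s : Fin p → ℝ}
    {w : EuclideanSpace ℝ (Fin n)} (hw : IsDualVec X A s w) :
    ∑ j ∈ A, s j ^ 2 ≤ cu * n * ‖w‖ ^ 2 ∧ cl * n * ‖w‖ ^ 2 ≤ ∑ j ∈ A, s j ^ 2 := by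
  have hcl : 0 < cl * n := mul_pos h.2.1 (by exact_mod_cast hn)
  have hcu : 0 < cu * n := mul_pos (h.2.1.trans h.2.2.1) (by exact_mod_cast hn)
  have hinner : ∀ u : Fin p → ℝ, (∀ j ∉ A, u j = 0) → ⟪linPred X u, w⟫ = ∑ j ∈ A, u j * s j := by
    intro u hu
    rw [inner_linPred]
    rw [← Finset.sum_subset (Finset.subset_univ A) fun j _ hj => by simp [hu j hj]]
    exact Finset.sum_congr rfl fun j hj => by rw [hw.2 j hj]
  have hsum : ∀ u : Fin p → ℝ, (∀ j ∉ A, u j = 0) → ∑ j, u j ^ 2 = ∑ j ∈ A, u j ^ 2 := by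
    intro u hu
    exact (Finset.sum_subset (Finset.subset_univ A) fun j _ hj => by simp [hu j hj]).symm
  set S := ∑ j ∈ A, s j ^ 2 with hS
  have hS0 : 0 ≤ S := Finset.sum_nonneg fun j _ => sq_nonneg _
  constructor
  · set u : Fin p → ℝ := fun j => if j ∈ A then s j else 0 with hu
    have hu0 : ∀ j ∉ A, u j = 0 := fun j hj => by simp [hu, hj]
    have h1 : ⟪linPred X u, w⟫ = S := by
      rw [hinner u hu0]
      exact Finset.sum_congr rfl fun j hj => by simp [hu, hj, sq]
    have h2 : ∑ j, u j ^ 2 = S := by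
      rw [hsum u hu0]
      exact Finset.sum_congr rfl fun j hj => by simp [hu, hj]
    have h3 := (h.bounds hn hA hu0).2
    rw [h2] at h3
    have h4 : S ^ 2 ≤ ‖linPred X u‖ ^ 2 * ‖w‖ ^ 2 := by
      rw [← h1, ← mul_pow, ← sq_abs]
      exact pow_le_pow_left₀ (abs_nonneg _) (abs_real_inner_le_norm _ _) 2
    rcases hS0.eq_or_lt with h0 | h0
    · rw [← h0]; positivity
    · have h5 : S * S ≤ S * (cu * n * ‖w‖ ^ 2) := by nlinarith [sq_nonneg ‖w‖]
      exact le_of_mul_le_mul_left h5 h0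
  · obtain ⟨v, hv, rfl⟩ := mem_colSpan_iff.1 hw.1
    have h1 := (h.bounds hn hA hv).1
    rw [hsum v hv] at h1
    have h2 : ‖linPred X v‖ ^ 2 = ∑ j ∈ A, v j * s j := by
      rw [← real_inner_self_eq_norm_sq, hinner v hv]
    have h3 : (∑ j ∈ A, v j * s j) ^ 2 ≤ (∑ j ∈ A, v j ^ 2) * S := Finset.sum_mul_sq_le_sq_mul_sq _ _ _
    rw [← h2] at h3
    rcases (sq_nonneg ‖linPred X v‖).eq_or_lt with h0 | h0
    · rw [← h0, mul_zero]; exact hS0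
    · refine le_of_mul_le_mul_left (a := ‖linPred X v‖ ^ 2) ?_ h0
      nlinarith

end Riesz

/-! ### The basic inequality -/

section Energy

variable {n p : ℕ}

/-- The coefficient vector that agrees with `u` on `S` and vanishes elsewhere. -/
def restr (S : Finset (Fin p)) (u : Fin p → ℝ) : Fin p → ℝ := fun j => if j ∈ S then u j else 0

lemma restr_of_notMem {S : Finset (Fin p)} (u : Fin p → ℝ) {j : Fin p} (hj : j ∉ S) :
    restr S u j = 0 := if_neg hj

lemma restr_of_mem {S : Finset (Fin p)} (u : Fin p → ℝ) {j : Fin p} (hj : j ∈ S) :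
    restr S u j = u j := if_pos hj

lemma restr_add_restr {S T U : Finset (Fin p)} (h : Disjoint S T) (hU : S ∪ T = U)
    (u : Fin p → ℝ) : restr S u + restr T u = restr U u := by
  subst hU
  ext j
  by_cases h1 : j ∈ S
  · simp [restr, h1, Finset.disjoint_left.1 h h1]
  · simp [restr, h1]

lemma linPred_restr (X : Matrix (Fin n) (Fin p) ℝ) (S : Finset (Fin p)) (u : Fin p → ℝ) :
    linPred X (restr S u) = ∑ j ∈ S, u j • designVec X j := by
  rw [linPred, ← Finset.sum_subset (Finset.subset_univ S) fun j _ hj => by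
    rw [restr_of_notMem u hj, zero_smul]]
  exact Finset.sum_congr rfl fun j hj => by rw [restr_of_mem u hj]

lemma inner_linPred_restr (X : Matrix (Fin n) (Fin p) ℝ) (S : Finset (Fin p)) (u : Fin p → ℝ)
    (w : EuclideanSpace ℝ (Fin n)) :
    ⟪linPred X (restr S u), w⟫ = ∑ j ∈ S, u j * ⟪designVec X j, w⟫ := by
  simp [linPred_restr, sum_inner, real_inner_smul_left]

lemma linPred_restr_mem (X : Matrix (Fin n) (Fin p) ℝ) (S : Finset (Fin p)) (u : Fin p → ℝ) :
    linPred X (restr S u) ∈ colSpan X S :=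
  mem_colSpan_iff.2 ⟨_, fun _ hj => restr_of_notMem u hj, rfl⟩

lemma sum_restr_sq (S : Finset (Fin p)) (u : Fin p → ℝ) :
    ∑ j, restr S u j ^ 2 = ∑ j ∈ S, u j ^ 2 := by
  rw [← Finset.sum_subset (Finset.subset_univ S) fun j _ hj => by
    rw [restr_of_notMem u hj]; norm_num]
  exact Finset.sum_congr rfl fun j hj => by rw [restr_of_mem u hj]

/-- `unexplained` only depends on the coefficients outside the model. -/
lemma unexplained_eq (X : Matrix (Fin n) (Fin p) ℝ) (β : Fin p → ℝ) (A : Finset (Fin p)) :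
    unexplained X β A = linPred X (restr Aᶜ β)
      - (colSpan X A).starProjection (linPred X (restr Aᶜ β)) := by
  have h : linPred X β = linPred X (restr A β) + linPred X (restr Aᶜ β) := by
    rw [← linPred_add, restr_add_restr (U := Finset.univ) disjoint_compl_right
      (by simp)]
    congr 1; ext j; simp [restr]
  rw [unexplained, h, map_add,
    Submodule.starProjection_eq_self_iff.2 (linPred_restr_mem X A β)]
  abel

lemma sub_starProjection_inner_eq_zero {E : Type*} [NormedAddCommGroup E] [InnerProductSpace ℝ E]
    (W : Submodule ℝ E) [W.HasOrthogonalProjection] (z : E) {w : E} (hw : w ∈ W) :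
    ⟪z - W.starProjection z, w⟫ = 0 :=
  Submodule.starProjection_inner_eq_zero z w hw

/-- The stationarity conditions paired with the penalised part `V₄ = l w₄` of the fit inside `A`
and with the coefficients outside `A`, added up. The cross terms between `V₄` and the unfitted mean
cancel. -/
lemma IsKKT.energy_le {X : Matrix (Fin n) (Fin p) ℝ} {β b : Fin p → ℝ}
    {ε : EuclideanSpace ℝ (Fin n)} {l : ℝ} (hl : 0 < l)
    (h : IsKKT X (linPred X β + ε) l b) {A A₄ : Finset (Fin p)} (hA : selected b ⊆ A)
    (hA₄ : A₄ ⊆ A) {s₃ s₄ : Fin p → ℝ} {w₃ w₄ : EuclideanSpace ℝ (Fin n)}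
    (hw₃ : IsDualVec X A s₃ w₃) (hw₄ : IsDualVec X A s₄ w₄)
    (hs : ∀ j ∈ A, l * (s₃ j + s₄ j) = ⟪designVec X j, linPred X β + ε - linPred X b⟫)
    (hs₃ : ∀ j ∈ A₄, s₃ j = 0) (hs₄ : ∀ j ∈ A, j ∉ A₄ → s₄ j = 0) :
    ‖l • w₄‖ ^ 2 + ‖unexplained X β A‖ ^ 2 ≤ - ⟪l • w₄, l • w₃⟫
      - ⟪linPred X (restr Aᶜ β), l • w₃⟫ + ⟪l • w₄ - unexplained X β A, ε⟫
      + l * (∑ j ∈ A₄, |β j| + ∑ j ∈ Aᶜ, |β j|) := by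
  set r := linPred X β + ε - linPred X b with hr
  set ω := unexplained X β A with hω
  set z := linPred X (restr Aᶜ β) with hz
  set V₃ := l • w₃
  set V₄ := l • w₄
  have hV₃ : V₃ ∈ colSpan X A := Submodule.smul_mem _ _ hw₃.1
  have hV₄ : V₄ ∈ colSpan X A := Submodule.smul_mem _ _ hw₄.1
  have hωA : ∀ u ∈ colSpan X A, ⟪ω, u⟫ = 0 := fun u hu =>
    sub_starProjection_inner_eq_zero _ _ hu
  have hb : restr A b = b := by
    ext j
    by_cases hj : j ∈ A
    · exact restr_of_mem b hj
    · rw [restr_of_notMem b hj]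
      by_contra h0
      exact hj (hA (Finset.mem_filter.2 ⟨Finset.mem_univ _, Ne.symm h0⟩))
  have hrV : ∀ u ∈ colSpan X A, ⟪u, r⟫ = ⟪u, V₃ + V₄⟫ := by
    intro u hu
    obtain ⟨v, hv, rfl⟩ := mem_colSpan_iff.1 hu
    rw [inner_linPred, inner_linPred]
    refine Finset.sum_congr rfl fun j _ => ?_
    by_cases hj : j ∈ A
    · rw [← hs j hj, inner_add_right, real_inner_smul_right, real_inner_smul_right, hw₃.2 j hj,
        hw₄.2 j hj]
      ring
    · rw [hv j hj]; ring
  have hβ : linPred X β = linPred X (restr A β) + z := by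
    rw [hz, ← linPred_add, restr_add_restr (U := Finset.univ) disjoint_compl_right (by simp)]
    congr 1; ext j; simp [restr]
  have hA' : linPred X (restr A β) ∈ colSpan X A := linPred_restr_mem X A β
  have hb' : linPred X b ∈ colSpan X A := hb ▸ linPred_restr_mem X A b
  have hinA : ∀ u : Fin p → ℝ, ⟪linPred X (restr A u), V₄⟫ = ∑ j ∈ A₄, u j * (l * s₄ j) := by
    intro u
    rw [inner_linPred_restr, ← Finset.sum_subset hA₄ fun j hj hj4 => by
      rw [real_inner_smul_right, hw₄.2 j hj, hs₄ j hj hj4]; ring]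
    exact Finset.sum_congr rfl fun j hj => by rw [real_inner_smul_right, hw₄.2 j (hA₄ hj)]
  have h1 : ⟪V₄, V₃ + V₄⟫ ≤ ⟪z, V₄⟫ + ⟪V₄, ε⟫ + l * ∑ j ∈ A₄, |β j| := by
    have e1 : ⟪V₄, V₃ + V₄⟫ = ⟪linPred X (restr A β), V₄⟫ + ⟪z, V₄⟫ + ⟪V₄, ε⟫
        - ⟪linPred X (restr A b), V₄⟫ := by
      rw [← hrV V₄ hV₄, hr, hβ, hb, inner_sub_right, inner_add_right, inner_add_right,
        real_inner_comm V₄, real_inner_comm V₄, real_inner_comm V₄ (linPred X b)]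
    have e2 : ⟪linPred X (restr A β), V₄⟫ - ⟪linPred X (restr A b), V₄⟫
        ≤ l * ∑ j ∈ A₄, |β j| := by
      rw [hinA, hinA, ← Finset.sum_sub_distrib, Finset.mul_sum]
      refine Finset.sum_le_sum fun j hj => ?_
      have e3 := hs j (hA₄ hj)
      rw [hs₃ j hj, zero_add] at e3
      rw [e3]
      have e4 := (h j).2
      have e5 : 0 ≤ l * |b j| := by positivity
      have e6 : β j * ⟪designVec X j, r⟫ ≤ l * |β j| := by
        calc _ ≤ |β j * ⟪designVec X j, r⟫| := le_abs_self _
          _ = |β j| * |⟪designVec X j, r⟫| := abs_mul _ _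
          _ ≤ |β j| * l := by gcongr; exact (h j).1
          _ = _ := mul_comm _ _
      linarith
    linarith
  have h2 : ⟪z, V₃ + V₄⟫ + ‖ω‖ ^ 2 + ⟪ω, ε⟫ ≤ l * ∑ j ∈ Aᶜ, |β j| := by
    have e1 : ⟪z, r⟫ ≤ l * ∑ j ∈ Aᶜ, |β j| := by
      rw [hz, inner_linPred_restr, Finset.mul_sum]
      refine Finset.sum_le_sum fun j _ => ?_
      calc _ ≤ |β j * ⟪designVec X j, r⟫| := le_abs_self _
        _ = |β j| * |⟪designVec X j, r⟫| := abs_mul _ _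
        _ ≤ |β j| * l := by gcongr; exact (h j).1
        _ = _ := mul_comm _ _
    have hPz : (colSpan X A).starProjection z ∈ colSpan X A :=
      Submodule.starProjection_apply_mem _ _
    have hzω : z = ω + (colSpan X A).starProjection z := by
      rw [hω, unexplained_eq]; abel
    have e2 : ⟪ω, r⟫ = ‖ω‖ ^ 2 + ⟪ω, ε⟫ := by
      rw [hr, hβ, inner_sub_right, inner_add_right, inner_add_right, hωA _ hA', hωA _ hb']
      conv_lhs => rw [hzω]
      rw [inner_add_right, hωA _ hPz, real_inner_self_eq_norm_sq]
      ring
    have e3 : ⟪z, r⟫ = ⟪z, V₃ + V₄⟫ + ⟪ω, r⟫ := by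
      conv_lhs => rw [hzω]
      conv_rhs => rw [hzω]
      rw [inner_add_left, inner_add_left, hrV _ hPz,
        hωA _ (Submodule.add_mem _ hV₃ hV₄)]
      ring
    linarith
  rw [inner_add_right, real_inner_self_eq_norm_sq] at h1
  rw [inner_add_right] at h2
  rw [inner_sub_left]
  linarith

/-- Sparse Riesz bounds for the Schur complement: projecting out the design vectors in `A` does not
bring the coefficients outside `A` below the lower spectrum bound. -/
lemma LassoRate.SparseRiesz.schur_bounds (hn : 0 < n) {X : Matrix (Fin n) (Fin p) ℝ} {qs : ℕ}
    {cl cu : ℝ} (h : SparseRiesz X qs cl cu) {A S : Finset (Fin p)} (hd : Disjoint S A)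
    (hc : (A ∪ S).card ≤ qs) (u : Fin p → ℝ) :
    cl * n * ∑ j ∈ S, u j ^ 2
        ≤ ‖linPred X (restr S u) - (colSpan X A).starProjection (linPred X (restr S u))‖ ^ 2 ∧
      cl * n * ∑ j ∈ S, u j ^ 2 + ‖(colSpan X A).starProjection (linPred X (restr S u))‖ ^ 2
        ≤ cu / cl *
          ‖linPred X (restr S u) - (colSpan X A).starProjection (linPred X (restr S u))‖ ^ 2 := by
  set z := linPred X (restr S u) with hz
  set P := (colSpan X A).starProjection with hP
  have hcl : 0 < cl := h.2.1
  have hcu : 0 < cu := hcl.trans h.2.2.1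
  have hPz : P z ∈ colSpan X A := Submodule.starProjection_apply_mem _ _
  have h1 : cl * n * ∑ j ∈ S, u j ^ 2 ≤ ‖z - P z‖ ^ 2 := by
    obtain ⟨v, hv, hvz⟩ := mem_colSpan_iff.1 hPz
    have e1 := (h.bounds hn hc (v := restr S u - v) (fun j hj => by
      rw [Finset.mem_union, not_or] at hj
      rw [Pi.sub_apply, restr_of_notMem u hj.2, hv j hj.1, sub_zero])).1
    rw [linPred_sub, hvz, ← hz] at e1
    refine le_trans ?_ e1
    rw [← sum_restr_sq]
    refine mul_le_mul_of_nonneg_left (Finset.sum_le_sum fun j _ => ?_) (by positivity)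
    rw [Pi.sub_apply]
    by_cases hj : j ∈ A
    · rw [restr_of_notMem u fun hS => Finset.disjoint_left.1 hd hS hj]
      nlinarith [sq_nonneg (v j)]
    · rw [hv j hj, sub_zero]
  refine ⟨h1, ?_⟩
  have h2 : ‖z‖ ^ 2 = ‖P z‖ ^ 2 + ‖z - P z‖ ^ 2 := by
    have e := sub_starProjection_inner_eq_zero (colSpan X A) z hPz
    have e2 : z = (z - P z) + P z := by abel
    conv_lhs => rw [e2]
    rw [norm_add_sq_real, e]
    ring
  have h3 := (h.bounds hn ((Finset.card_le_card Finset.subset_union_right).trans hc)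
    (v := restr S u) fun j hj => restr_of_notMem u hj).2
  rw [sum_restr_sq, ← hz] at h3
  have h4 : cu * n * ∑ j ∈ S, u j ^ 2 ≤ cu / cl * ‖z - P z‖ ^ 2 := by
    calc cu * n * ∑ j ∈ S, u j ^ 2 = cu / cl * (cl * n * ∑ j ∈ S, u j ^ 2) := by
          field_simp
      _ ≤ _ := by gcongr
  linarith

lemma add_sq_le_of_sq_le {a₁ a₂ k₁ k₂ m₁ m₂ : ℝ} (hk₁ : 0 ≤ k₁)
    (hk₂ : 0 ≤ k₂) (hm₁ : 0 ≤ m₁) (hm₂ : 0 ≤ m₂) (h₁ : a₁ ^ 2 ≤ k₁ * m₁) (h₂ : a₂ ^ 2 ≤ k₂ * m₂) :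
    (a₁ + a₂) ^ 2 ≤ (k₁ + k₂) * (m₁ + m₂) := by
  have h3 : (2 * (a₁ * a₂)) ^ 2 ≤ (k₁ * m₂ + k₂ * m₁) ^ 2 := by
    have := mul_le_mul h₁ h₂ (sq_nonneg _) (by positivity)
    nlinarith [sq_nonneg (k₁ * m₂ - k₂ * m₁)]
  have h4 := abs_le_of_sq_le_sq h3 (by positivity)
  nlinarith [(abs_le.1 h4).2]

lemma sum_restr_sq_of_subset {A S : Finset (Fin p)} (hS : S ⊆ A) (s : Fin p → ℝ) :
    ∑ j ∈ A, restr S s j ^ 2 = ∑ j ∈ S, s j ^ 2 := by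
  rw [← Finset.sum_subset hS fun j _ hj => by rw [restr_of_notMem s hj]; norm_num]
  exact Finset.sum_congr rfl fun j hj => by rw [restr_of_mem s hj]

/-- The noise enters along `V₄ - (I - P_A) X β`, where `V₄ = l w₄` and `w₄` carries the signs of the
selected small coefficients and the sign `0` on the rest of the model. -/
lemma noise_sq_le (hn : 0 < n) {X : Matrix (Fin n) (Fin p) ℝ} {qs : ℕ} {cl cu : ℝ}
    (hX : SparseRiesz X qs cl cu) {β : Fin p → ℝ} {ε : EuclideanSpace ℝ (Fin n)} {K l : ℝ}
    {A S : Finset (Fin p)} (hA : A.card ≤ qs) (hS : S ⊆ A) {s : Fin p → ℝ}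
    (hs : ∀ j ∈ S, |s j| = 1) {w : EuclideanSpace ℝ (Fin n)} (hw : IsDualVec X A (restr S s) w)
    (hnoise : ∀ s : Fin p → ℝ, (∀ j ∈ A, s j = -1 ∨ s j = 0 ∨ s j = 1) →
      (A = ∅ ∨ ∃ j ∈ A, s j ≠ 0) → ∀ u ∈ noisePlane X β A s, ⟪ε, u⟫ ^ 2 ≤ K * ‖u‖ ^ 2) :
    ⟪l • w - unexplained X β A, ε⟫ ^ 2 ≤ K * (‖l • w‖ ^ 2 + ‖unexplained X β A‖ ^ 2) := by
  have horth : ⟪l • w, unexplained X β A⟫ = 0 := by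
    rw [real_inner_comm]
    exact sub_starProjection_inner_eq_zero _ _ (Submodule.smul_mem _ _ hw.1)
  have hun : ‖l • w - unexplained X β A‖ ^ 2 = ‖l • w‖ ^ 2 + ‖unexplained X β A‖ ^ 2 := by
    rw [norm_sub_sq_real, horth]; ring
  rw [← hun, real_inner_comm]
  rcases S.eq_empty_or_nonempty with h4 | ⟨j, hj⟩
  · -- no small coefficient is selected: `w = 0`, and any nonzero signs will do
    have hw0 : w = 0 := by
      have e1 := (hw.norm_sq_bounds hn hX hA).2
      rw [sum_restr_sq_of_subset hS, h4, Finset.sum_empty] at e1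
      have hcl : 0 < cl * n := mul_pos hX.2.1 (by exact_mod_cast hn)
      have e3 : ‖w‖ ^ 2 ≤ 0 := nonpos_of_mul_nonpos_right e1 hcl
      exact norm_eq_zero.1
        (pow_eq_zero_iff two_ne_zero |>.1 (le_antisymm e3 (sq_nonneg _)))
    refine hnoise (fun _ => 1) (fun _ _ => by simp) ?_ _ ?_
    · rcases A.eq_empty_or_nonempty with hA0 | ⟨j, hj⟩
      · exact Or.inl hA0
      · exact Or.inr ⟨j, hj, one_ne_zero⟩
    · rw [hw0, smul_zero, zero_sub]
      exact Submodule.neg_mem _ (Submodule.subset_span (Or.inr rfl))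
  · refine hnoise (restr S s) (fun i _ => ?_) (Or.inr ⟨j, hS hj, ?_⟩) _ ?_
    · by_cases hi : i ∈ S
      · rw [restr_of_mem s hi]
        rcases eq_or_eq_neg_of_abs_eq (hs i hi) with h' | h'
        · exact Or.inr (Or.inr h')
        · exact Or.inl h'
      · exact Or.inr (Or.inl (restr_of_notMem s hi))
    · rw [restr_of_mem s hj]
      intro h0
      have := hs j hj
      rw [h0, abs_zero] at this
      exact zero_ne_one this
    · exact Submodule.sub_mem _
        (Submodule.smul_mem _ _ (Submodule.subset_span (Or.inl hw)))
        (Submodule.subset_span (Or.inr rfl))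

set_option maxHeartbeats 1000000 in
/-- The basic inequality. Here `v` is the norm of the fit due to the selected small coefficients,
`o` the norm of the unexplained mean and `x` the norm of its part due to missed large coefficients;
`D ^ 2 = q l² / (c^* n)`. -/
lemma IsKKT.basic_inequality (hn : 0 < n) {X : Matrix (Fin n) (Fin p) ℝ} {qs q : ℕ} {cl cu η₁ : ℝ}
    (hX : SparseRiesz X qs cl cu) {β b : Fin p → ℝ} {A0 : Finset (Fin p)} (hq : 1 ≤ q)
    (hβ : Sparsity β A0 q η₁) {ε : EuclideanSpace ℝ (Fin n)} {l : ℝ} (hl : 0 < l)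
    (h : IsKKT X (linPred X β + ε) l b) {A : Finset (Fin p)} (hA : selected b ⊆ A)
    (hA' : A ⊆ equiSet X (linPred X β + ε) l b ∪ A0ᶜ) (hAc : (A ∪ A0ᶜ).card ≤ qs)
    (hnoise : ∀ s : Fin p → ℝ, (∀ j ∈ A, s j = -1 ∨ s j = 0 ∨ s j = 1) →
      (A = ∅ ∨ ∃ j ∈ A, s j ≠ 0) → ∀ u ∈ noisePlane X β A s,
        ⟪ε, u⟫ ^ 2 ≤ l ^ 2 / (4 * (cu * n)) * (max A.card 1 : ℕ) * ‖u‖ ^ 2) :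
    ∃ v x D : ℝ, 0 ≤ v ∧ 0 ≤ x ∧ 0 < D ∧ D ^ 2 = q * l ^ 2 / (cu * n) ∧
      v ^ 2 / 2 + 3 / 4 * ‖unexplained X β A‖ ^ 2 ≤ √(cu / cl) * D * v
        + √(cu / cl) * D * eta2 X β A0 + cu / cl * D * x + l * η₁ + D ^ 2 / 4 ∧
      |x - ‖unexplained X β A‖| ≤ eta2 X β A0 ∧
      (A ∩ A0).card * D ^ 2 ≤ v ^ 2 * q ∧
      cl * n * ∑ j ∈ A0ᶜ \ A, β j ^ 2 ≤ x ^ 2 ∧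
      (A0ᶜ ⊆ A → x = 0) := by
  obtain ⟨hcl, hclu⟩ : 0 < cl ∧ cl < cu := ⟨hX.2.1, hX.2.2.1⟩
  have hcu : 0 < cu := hcl.trans hclu
  have hn' : (0 : ℝ) < n := by exact_mod_cast hn
  have hq' : (1 : ℝ) ≤ q := by exact_mod_cast hq
  obtain ⟨hqc, hη₁⟩ := hβ
  set A₃ := A \ A0 with hA₃
  set A₄ := A ∩ A0 with hA₄
  set A₅ := A0ᶜ \ A with hA₅
  set A₆ := A0 \ A with hA₆
  have hAqs : A.card ≤ qs := (Finset.card_le_card Finset.subset_union_left).trans hAc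
  have hq35 : A₃.card + A₅.card = q := by
    rw [← hqc, ← Finset.card_inter_add_card_sdiff A0ᶜ A]
    congr 2
    ext j; simp [hA₃, and_comm]
  have hq34 : A.card = A₄.card + A₃.card := (Finset.card_inter_add_card_sdiff A A0).symm
  set r := linPred X β + ε - linPred X b with hr
  -- the scaled correlations: a subgradient of the `ℓ₁` norm, of modulus one on `A₄`
  set s : Fin p → ℝ := fun j => ⟪designVec X j, r⟫ / l with hs
  have hs1 : ∀ j, |s j| ≤ 1 := fun j => by
    rw [hs, abs_div, abs_of_pos hl, div_le_one hl]; exact (h j).1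
  have hs4 : ∀ j ∈ A₄, |s j| = 1 := by
    intro j hj
    rw [hA₄, Finset.mem_inter] at hj
    have : j ∈ equiSet X (linPred X β + ε) l b := by
      rcases Finset.mem_union.1 (hA' hj.1) with h' | h'
      · exact h'
      · exact absurd hj.2 (Finset.mem_compl.1 h')
    rw [hs, abs_div, abs_of_pos hl, div_eq_one_iff_eq hl.ne']
    exact (Finset.mem_filter.1 this).2
  obtain ⟨w₃, hw₃⟩ := exists_isDualVec hn hX hAqs (restr A₃ s)
  obtain ⟨w₄, hw₄⟩ := exists_isDualVec hn hX hAqs (restr A₄ s)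
  set ω := unexplained X β A with hω
  set V₃ := l • w₃ with hV₃
  set V₄ := l • w₄ with hV₄
  set P := (colSpan X A).starProjection with hP
  set z₅ := linPred X (restr A₅ β) with hz₅
  set z₆ := linPred X (restr A₆ β) with hz₆
  set η₂ := eta2 X β A0 with hη₂
  have henergy := h.energy_le hl hA (A₄ := A₄) Finset.inter_subset_left hw₃ hw₄ (fun j hj => by
      have : restr A₃ s j + restr A₄ s j = s j := by
        by_cases hj0 : j ∈ A0 <;> simp [restr, hA₃, hA₄, hj, hj0]
      rw [this, hs]
      exact mul_div_cancel₀ _ hl.ne')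
    (fun j hj => restr_of_notMem s fun hj' => by
      simp only [hA₃, hA₄, Finset.mem_inter, Finset.mem_sdiff] at hj hj'; exact hj'.2 hj.2)
    (fun j _ hj => restr_of_notMem s hj)
  rw [← hV₃, ← hV₄, ← hω] at henergy
  have hsplit : linPred X (restr Aᶜ β) = z₅ + z₆ := by
    rw [hz₅, hz₆, ← linPred_add, restr_add_restr (U := Aᶜ)]
    · rw [Finset.disjoint_left]; intro j hj hj'
      simp only [hA₅, hA₆, Finset.mem_sdiff, Finset.mem_compl] at hj hj'; exact hj.1 hj'.1
    · ext j
      simp only [hA₅, hA₆, Finset.mem_union, Finset.mem_sdiff, Finset.mem_compl]; tauto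
  -- size of the small coefficients
  have hsmall : ∑ j ∈ A₄, |β j| + ∑ j ∈ Aᶜ, |β j| ≤ η₁ + ∑ j ∈ A₅, |β j| := by
    have e1 : ∑ j ∈ Aᶜ, |β j| = ∑ j ∈ A₅, |β j| + ∑ j ∈ A₆, |β j| := by
      rw [← Finset.sum_union]
      · congr 1; ext j
        simp only [hA₅, hA₆, Finset.mem_union, Finset.mem_sdiff, Finset.mem_compl]; tauto
      · rw [Finset.disjoint_left]; intro j hj hj'
        simp only [hA₅, hA₆, Finset.mem_sdiff, Finset.mem_compl] at hj hj'; exact hj.1 hj'.1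
    have e2 : ∑ j ∈ A₄, |β j| + ∑ j ∈ A₆, |β j| = ∑ j ∈ A0, |β j| := by
      rw [hA₄, Finset.inter_comm, hA₆]
      exact Finset.sum_inter_add_sum_sdiff A0 A _
    linarith
  have hz₆n : ‖z₆‖ ≤ η₂ := by
    rw [hz₆, linPred_restr, hη₂, eta2]
    exact Finset.le_sup' (fun S => ‖∑ j ∈ S, β j • designVec X j‖)
      (Finset.mem_powerset.2 Finset.sdiff_subset)
  set x := ‖z₅ - P z₅‖ with hx
  have hω56 : ω = (z₅ - P z₅) + (z₆ - P z₆) := by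
    rw [hω, unexplained_eq, hsplit, map_add]; abel
  have hz₆P : ‖z₆ - P z₆‖ ≤ η₂ := by
    refine le_trans ?_ hz₆n
    have e := sub_starProjection_inner_eq_zero (colSpan X A) z₆
      (Submodule.starProjection_apply_mem (colSpan X A) z₆)
    have e2 : ‖z₆‖ ^ 2 = ‖z₆ - P z₆‖ ^ 2 + ‖P z₆‖ ^ 2 := by
      conv_lhs => rw [show z₆ = (z₆ - P z₆) + P z₆ by abel]
      rw [norm_add_sq_real, e]; ring
    exact le_of_sq_le_sq (by nlinarith [sq_nonneg ‖P z₆‖]) (norm_nonneg _)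
  have hxo : |x - ‖ω‖| ≤ η₂ := by
    refine (abs_norm_sub_norm_le _ _).trans ?_
    rw [hω56, sub_add_cancel_left, norm_neg]
    exact hz₆P
  obtain ⟨hsch1, hsch2⟩ := hX.schur_bounds hn (A := A) (S := A₅) Finset.sdiff_disjoint
    ((Finset.card_le_card (Finset.union_subset_union_right Finset.sdiff_subset)).trans hAc) β
  rw [← hz₅, ← hP, ← hx] at hsch1 hsch2
  have hη₂0 : 0 ≤ η₂ := (norm_nonneg _).trans hz₆n
  -- the norms of the two dual vectors
  have hV₃n : cl * n * ‖V₃‖ ^ 2 ≤ l ^ 2 * A₃.card := by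
    have e1 := (hw₃.norm_sq_bounds hn hX hAqs).2
    have e2 : ∑ j ∈ A, restr A₃ s j ^ 2 ≤ A₃.card := by
      rw [sum_restr_sq_of_subset Finset.sdiff_subset, ← nsmul_one, ← Finset.sum_const]
      refine Finset.sum_le_sum fun j _ => ?_
      rw [← sq_abs]
      exact pow_le_one₀ (abs_nonneg _) (hs1 j)
    rw [hV₃, norm_smul, mul_pow, Real.norm_eq_abs, sq_abs]
    nlinarith [sq_nonneg l]
  have hV₄n : l ^ 2 * A₄.card ≤ cu * n * ‖V₄‖ ^ 2 := by
    have e1 := (hw₄.norm_sq_bounds hn hX hAqs).1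
    have e2 : ∑ j ∈ A, restr A₄ s j ^ 2 = A₄.card := by
      rw [sum_restr_sq_of_subset Finset.inter_subset_left, ← nsmul_one, ← Finset.sum_const]
      refine Finset.sum_congr rfl fun j hj => ?_
      rw [← sq_abs, hs4 j hj, one_pow]
    rw [hV₄, norm_smul, mul_pow, Real.norm_eq_abs, sq_abs]
    nlinarith [sq_nonneg l]
  set D := √(q * l ^ 2 / (cu * n)) with hD
  have hDpos : 0 < D := Real.sqrt_pos.2 (by positivity)
  have hD2 : D ^ 2 = q * l ^ 2 / (cu * n) := Real.sq_sqrt (by positivity)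
  have hC : √(cu / cl) ^ 2 = cu / cl := Real.sq_sqrt (by positivity)
  have hCD : cu / cl * D ^ 2 = l ^ 2 * q / (cl * n) := by
    rw [hD2]; field_simp
  have hV₃le : ‖V₃‖ ≤ √(cu / cl) * D := by
    refine le_of_sq_le_sq ?_ (by positivity)
    rw [mul_pow, hC, hCD, le_div_iff₀ (by positivity), mul_comm]
    refine hV₃n.trans (mul_le_mul_of_nonneg_left ?_ (sq_nonneg l))
    exact_mod_cast (by omega : A₃.card ≤ q)
  -- missed large coefficients, by Cauchy–Schwarz over the two kinds of large coefficients
  have hlarge : l * ∑ j ∈ A₅, |β j| + ‖V₃‖ * ‖P z₅‖ ≤ cu / cl * D * x := by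
    refine le_of_sq_le_sq ?_ (by positivity)
    have e1 : (l * ∑ j ∈ A₅, |β j|) ^ 2
        ≤ (l ^ 2 * A₅.card / (cl * n)) * (cl * n * ∑ j ∈ A₅, β j ^ 2) := by
      have := sq_sum_le_card_mul_sum_sq (s := A₅) (f := fun j => |β j|)
      simp only [sq_abs] at this
      rw [mul_pow]
      calc _ ≤ l ^ 2 * (A₅.card * ∑ j ∈ A₅, β j ^ 2) := by gcongr
        _ = _ := by field_simp
    have e2 : (‖V₃‖ * ‖P z₅‖) ^ 2 ≤ (l ^ 2 * A₃.card / (cl * n)) * ‖P z₅‖ ^ 2 := by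
      rw [mul_pow]
      gcongr
      rw [le_div_iff₀ (by positivity), mul_comm]
      exact hV₃n
    refine (add_sq_le_of_sq_le (by positivity) (by positivity)
      (mul_nonneg (by positivity) (Finset.sum_nonneg fun j _ => sq_nonneg _))
      (sq_nonneg _) e1 e2).trans ?_
    have e3 : l ^ 2 * (A₅.card : ℝ) / (cl * n) + l ^ 2 * A₃.card / (cl * n) = cu / cl * D ^ 2 := by
      rw [hCD, ← hq35]; push_cast; ring
    rw [e3]
    calc _ ≤ cu / cl * D ^ 2 * (cu / cl * x ^ 2) := by gcongr
      _ = _ := by ring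
  -- the noise term
  have hnoise' : ⟪V₄ - ω, ε⟫ ^ 2
      ≤ l ^ 2 / (4 * (cu * n)) * (max A.card 1 : ℕ) * (‖V₄‖ ^ 2 + ‖ω‖ ^ 2) :=
    noise_sq_le hn hX hAqs Finset.inter_subset_left hs4 hw₄ hnoise
  have hnoise'' : ⟪V₄ - ω, ε⟫ ≤ (2 * ‖V₄‖ ^ 2 + ‖ω‖ ^ 2 + D ^ 2) / 4 := by
    have e1 : l ^ 2 / (cu * n) * (max A.card 1 : ℕ) ≤ ‖V₄‖ ^ 2 + D ^ 2 := by
      have : ((max A.card 1 : ℕ) : ℝ) ≤ A₄.card + q := by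
        exact_mod_cast (by omega : max A.card 1 ≤ A₄.card + q)
      calc _ ≤ l ^ 2 / (cu * n) * (A₄.card + q) := by gcongr
        _ = l ^ 2 * A₄.card / (cu * n) + D ^ 2 := by rw [hD2]; ring
        _ ≤ _ := by
          gcongr
          rw [div_le_iff₀ (by positivity), mul_comm (‖V₄‖ ^ 2)]
          exact hV₄n
    have e2 : ⟪V₄ - ω, ε⟫ ^ 2 ≤ 1 / 4 * (‖V₄‖ ^ 2 + D ^ 2) * (‖V₄‖ ^ 2 + ‖ω‖ ^ 2) := by
      refine hnoise'.trans (mul_le_mul_of_nonneg_right ?_ (by positivity))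
      calc _ = 1 / 4 * (l ^ 2 / (cu * n) * (max A.card 1 : ℕ)) := by
            field_simp
        _ ≤ _ := by gcongr
    refine le_of_sq_le_sq (e2.trans ?_) (by positivity)
    nlinarith [sq_nonneg (‖V₄‖ ^ 2 + D ^ 2 - (‖V₄‖ ^ 2 + ‖ω‖ ^ 2))]
  -- the cross terms with `V₃`
  have hc1 : - ⟪V₄, V₃⟫ ≤ √(cu / cl) * D * ‖V₄‖ := by
    calc - ⟪V₄, V₃⟫ ≤ |⟪V₄, V₃⟫| := neg_le_abs _
      _ ≤ ‖V₄‖ * ‖V₃‖ := abs_real_inner_le_norm _ _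
      _ ≤ ‖V₄‖ * (√(cu / cl) * D) := by gcongr
      _ = _ := mul_comm _ _
  have hc2 : - ⟪z₆, V₃⟫ ≤ √(cu / cl) * D * η₂ := by
    calc - ⟪z₆, V₃⟫ ≤ |⟪z₆, V₃⟫| := neg_le_abs _
      _ ≤ ‖z₆‖ * ‖V₃‖ := abs_real_inner_le_norm _ _
      _ ≤ η₂ * (√(cu / cl) * D) := by gcongr
      _ = _ := mul_comm _ _
  have hc3 : - ⟪z₅, V₃⟫ ≤ ‖V₃‖ * ‖P z₅‖ := by
    have e1 : ⟪z₅, V₃⟫ = ⟪P z₅, V₃⟫ := by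
      have := sub_starProjection_inner_eq_zero (colSpan X A) z₅
        (Submodule.smul_mem _ l hw₃.1)
      rw [inner_sub_left, sub_eq_zero] at this
      exact this
    rw [e1, mul_comm]
    exact (neg_le_abs _).trans (abs_real_inner_le_norm _ _)
  refine ⟨‖V₄‖, x, D, norm_nonneg _, norm_nonneg _, hDpos, hD2, ?_, hxo, ?_, hsch1, ?_⟩
  · rw [hsplit, inner_add_left] at henergy
    have := mul_le_mul_of_nonneg_left hsmall hl.le
    linarith
  · rw [hD2]
    calc (A₄.card : ℝ) * (q * l ^ 2 / (cu * n)) = (l ^ 2 * A₄.card) / (cu * n) * q := by ring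
      _ ≤ _ := by
        gcongr
        rw [div_le_iff₀ (by positivity), mul_comm (‖V₄‖ ^ 2)]
        exact hV₄n
  · intro hsub
    have : A₅ = ∅ := Finset.sdiff_eq_empty_iff_subset.2 hsub
    rw [hx, hz₅, linPred_restr, this]
    simp

end Energy

/-! ### Monotonicity of the constants in the penalty level -/

section Constants

variable {n p q qs : ℕ} {η₁ η₂ cl cu l : ℝ}

lemma r₁_sq (hη₁ : 0 ≤ η₁) (hcu : 0 ≤ cu) (hl : 0 ≤ l) :
    r₁ n q η₁ cu l ^ 2 = cu * η₁ * n / (q * l) :=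
  Real.sq_sqrt (by positivity)

lemma r₂_sq (hcu : 0 ≤ cu) : r₂ n q η₂ cu l ^ 2 = cu * η₂ ^ 2 * n / (q * l ^ 2) :=
  Real.sq_sqrt (by positivity)

lemma two_le_M₁ (hcl : 0 < cl) (hcu : 0 < cu) : 2 ≤ M₁ n q η₁ η₂ cl cu l := by
  have h1 : 0 ≤ r₂ n q η₂ cu l := Real.sqrt_nonneg _
  have h2 : 0 ≤ √(cu / cl) * r₂ n q η₂ cu l := by positivity
  have h3 : 0 < cu / cl := by positivity
  unfold M₁
  nlinarith [sq_nonneg (r₁ n q η₁ cu l)]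

lemma M₁_anti (hq : 1 ≤ q) (hη₁ : 0 ≤ η₁) (hcu : 0 < cu) {l' : ℝ} (hl : 0 < l)
    (hll : l ≤ l') : M₁ n q η₁ η₂ cl cu l' ≤ M₁ n q η₁ η₂ cl cu l := by
  have hq' : (0 : ℝ) < q := by exact_mod_cast hq
  have h1 : r₁ n q η₁ cu l' ≤ r₁ n q η₁ cu l := by unfold r₁; gcongr
  have h2 : r₂ n q η₂ cu l' ≤ r₂ n q η₂ cu l := by unfold r₂; gcongr
  have h3 : r₁ n q η₁ cu l' ^ 2 ≤ r₁ n q η₁ cu l ^ 2 :=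
    pow_le_pow_left₀ (Real.sqrt_nonneg _) h1 2
  unfold M₁
  gcongr

lemma continuousAt_M₁ (hq : 1 ≤ q) (hl : 0 < l) : ContinuousAt (M₁ n q η₁ η₂ cl cu) l := by
  have hq' : (0 : ℝ) < q := by exact_mod_cast hq
  have h1 : (q : ℝ) * l ≠ 0 := by positivity
  have h2 : (q : ℝ) * l ^ 2 ≠ 0 := by positivity
  unfold M₁ r₁ r₂
  fun_prop (disch := assumption)

lemma set_nonempty_of_lamStar_le (h : lamStar n q qs η₁ η₂ cl cu ≤ (l : EReal)) :
    ∃ l' : ℝ, 0 < l' ∧ M₁ n q η₁ η₂ cl cu l' * q + 1 ≤ qs := by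
  by_contra hne
  push Not at hne
  have : {l : ℝ | 0 < l ∧ M₁ n q η₁ η₂ cl cu l * q + 1 ≤ qs} = ∅ := by
    ext l'
    simpa using hne l'
  rw [lamStar, this, Set.image_empty, sInf_empty, top_le_iff] at h
  exact EReal.coe_ne_top _ h

/-- The infimum defining `λ_*` is attained from the right, by monotonicity and continuity. -/
lemma M₁_mul_add_one_le (hq : 1 ≤ q) (hη₁ : 0 ≤ η₁) (hcu : 0 < cu) (hl : 0 < l)
    (h : lamStar n q qs η₁ η₂ cl cu ≤ (l : EReal)) : M₁ n q η₁ η₂ cl cu l * q + 1 ≤ qs := by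
  have hright : ∀ μ, l < μ → M₁ n q η₁ η₂ cl cu μ * q + 1 ≤ qs := by
    intro μ hμ
    obtain ⟨_, ⟨l', ⟨hl'0, hl'⟩, rfl⟩, hlt⟩ := sInf_lt_iff.1
      (h.trans_lt (EReal.coe_lt_coe_iff.2 hμ))
    have := M₁_anti (n := n) (η₂ := η₂) (cl := cl) hq hη₁ hcu hl'0 (EReal.coe_lt_coe_iff.1 hlt).le
    refine le_trans ?_ hl'
    gcongr
  have hcont : ContinuousAt (fun μ => M₁ n q η₁ η₂ cl cu μ * q + 1) l :=
    ((continuousAt_M₁ hq hl).mul continuousAt_const).add continuousAt_const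
  exact le_of_tendsto (hcont.tendsto.mono_left nhdsWithin_le_nhds)
    (eventually_nhdsWithin_of_forall (s := Set.Ioi l) fun μ hμ => hright μ hμ)

end Constants

/-! ### Completing squares -/

section Bounds

/-- Completing squares in the basic inequality when no large coefficient is missed. -/
lemma small_fit_bound {t v o D ρ₁ ρ₂ : ℝ}
    (h : v ^ 2 / 2 + 3 / 4 * o ^ 2 ≤ t * D * v + t * D * (ρ₂ * D) + ρ₁ ^ 2 * D ^ 2 + D ^ 2 / 4) :
    v ^ 2 ≤ (1 + 4 * ρ₁ ^ 2 + 4 * t * ρ₂ + 4 * t ^ 2) * D ^ 2 := by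
  nlinarith [sq_nonneg (v / 2 - t * D), sq_nonneg o]

lemma unexplained_bound {t C v o x D ρ₁ ρ₂ : ℝ} (hC : 0 ≤ C) (hD : 0 ≤ D) (ht : t ^ 2 = C)
    (hxo : x - o ≤ ρ₂ * D)
    (h : v ^ 2 / 2 + 3 / 4 * o ^ 2 ≤ t * D * v + t * D * (ρ₂ * D) + C * D * x + ρ₁ ^ 2 * D ^ 2
      + D ^ 2 / 4) :
    o ^ 2 ≤ 8 / 3 * (1 / 4 + ρ₁ ^ 2 + ρ₂ * (t + C) + C / 2 + 2 / 3 * C ^ 2) * D ^ 2 := by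
  have h1 : C * D * x ≤ C * D * (o + ρ₂ * D) :=
    mul_le_mul_of_nonneg_left (by linarith) (by positivity)
  have h2 : t * D * v ≤ v ^ 2 / 2 + C * D ^ 2 / 2 := by
    rw [← ht]; nlinarith [sq_nonneg (v - t * D)]
  nlinarith [sq_nonneg (3 / 4 * o - C * D)]

/-- If `x ≤ ρ₂ D` the term `3 ρ₂² / 4` alone suffices; otherwise `o ≥ x - ρ₂ D` gives a quadratic
inequality for `x`. -/
lemma missed_bound {t C v o x D ρ₁ ρ₂ : ℝ} (hC : 0 ≤ C) (ht0 : 0 ≤ t)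
    (ht : t ^ 2 = C) (hx : 0 ≤ x) (hρ₂ : 0 ≤ ρ₂) (hxo : x - o ≤ ρ₂ * D)
    (h : v ^ 2 / 2 + 3 / 4 * o ^ 2 ≤ t * D * v + t * D * (ρ₂ * D) + C * D * x + ρ₁ ^ 2 * D ^ 2
      + D ^ 2 / 4) :
    x ^ 2 ≤ 8 / 3 * (1 / 4 + ρ₁ ^ 2 + ρ₂ * (t + 2 * C) + 3 * ρ₂ ^ 2 / 4 + C / 2 + 2 / 3 * C ^ 2)
      * D ^ 2 := by
  rcases le_total x (ρ₂ * D) with hc | hc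
  · have h1 : x ^ 2 ≤ ρ₂ ^ 2 * D ^ 2 := by
      rw [← mul_pow]; exact pow_le_pow_left₀ hx hc 2
    have h2 : 0 ≤ (8 / 3 * (1 / 4 + ρ₁ ^ 2 + ρ₂ * (t + 2 * C) + 3 * ρ₂ ^ 2 / 4 + C / 2
        + 2 / 3 * C ^ 2) - ρ₂ ^ 2) * D ^ 2 := by
      have : 0 ≤ 8 / 3 * (1 / 4 + ρ₁ ^ 2 + ρ₂ * (t + 2 * C) + ρ₂ ^ 2 * (3 / 8) + C / 2
        + 2 / 3 * C ^ 2) := by positivity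
      refine mul_nonneg ?_ (sq_nonneg D)
      nlinarith [sq_nonneg ρ₂]
    nlinarith
  · have h1 : (x - ρ₂ * D) ^ 2 ≤ o ^ 2 :=
      pow_le_pow_left₀ (by linarith) (by linarith) 2
    have h2 : t * D * v ≤ v ^ 2 / 2 + C * D ^ 2 / 2 := by
      rw [← ht]; nlinarith [sq_nonneg (v - t * D)]
    nlinarith [sq_nonneg (3 / 4 * x - (C + 3 / 2 * ρ₂) * D)]

end Bounds

/-! ### The bounds on the good event -/

section Main

variable {n p : ℕ}

/-- On the good event, noise of standard deviation `σ` is dominated by penalty levels above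
`λ_{n,p}`. -/
lemma noise_bound_of_goodEvent (hn : 0 < n) {X : Matrix (Fin n) (Fin p) ℝ} {β : Fin p → ℝ}
    {c₀ a σ cu l : ℝ} (hp : 0 < p) (hc₀ : 0 ≤ c₀) (hσ : 0 < σ) (hcu : 0 < cu)
    (hl : lamNP n p σ c₀ a cu ≤ l) {ε : EuclideanSpace ℝ (Fin n)}
    (he : σ⁻¹ • ε ∈ goodEvent X β c₀ a) (A : Finset (Fin p)) (s : Fin p → ℝ)
    (hs : ∀ j ∈ A, s j = -1 ∨ s j = 0 ∨ s j = 1) (hA : A = ∅ ∨ ∃ j ∈ A, s j ≠ 0)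
    (u : EuclideanSpace ℝ (Fin n)) (hu : u ∈ noisePlane X β A s) :
    ⟪ε, u⟫ ^ 2 ≤ l ^ 2 / (4 * (cu * n)) * (max A.card 1 : ℕ) * ‖u‖ ^ 2 := by
  have hn' : (0 : ℝ) < n := by exact_mod_cast hn
  have hlog : 0 ≤ Real.log (max (p : ℝ) a) :=
    Real.log_nonneg (le_max_of_le_left (by exact_mod_cast hp))
  have h1 := inner_sq_le_of_mem_goodEvent he hs hA hu
  rw [real_inner_smul_left, mul_pow, inv_pow, inv_mul_le_iff₀ (by positivity)] at h1
  refine h1.trans ?_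
  rw [← mul_assoc]
  refine mul_le_mul_of_nonneg_right ?_ (sq_nonneg _)
  have h2 : lamNP n p σ c₀ a cu ^ 2 ≤ l ^ 2 :=
    pow_le_pow_left₀ (by unfold lamNP; positivity) hl 2
  rw [lamNP, mul_pow, Real.sq_sqrt (by positivity)] at h2
  rw [noiseLevel, ← mul_assoc]
  gcongr
  rw [le_div_iff₀ (by positivity)]
  linarith

/-- `D = l (q / (c^* n))^{1/2}` is the unit in which `r₁²` and `r₂` measure `l η₁` and `η₂`. -/
lemma eta_eq {q : ℕ} {η₁ η₂ cu l D : ℝ} (hn : 0 < n) (hq : 1 ≤ q) (hcu : 0 < cu) (hη₁ : 0 ≤ η₁)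
    (hη₂ : 0 ≤ η₂) (hl : 0 < l) (hD : 0 < D) (hD2 : D ^ 2 = q * l ^ 2 / (cu * n)) :
    l * η₁ = r₁ n q η₁ cu l ^ 2 * D ^ 2 ∧ η₂ = r₂ n q η₂ cu l * D := by
  have hn' : (0 : ℝ) < n := by exact_mod_cast hn
  have hq' : (0 : ℝ) < q := by exact_mod_cast hq
  constructor
  · rw [r₁_sq hη₁ hcu.le hl.le, hD2]; field_simp
  · have h0 : 0 ≤ r₂ n q η₂ cu l := Real.sqrt_nonneg _
    rw [← sq_eq_sq₀ hη₂ (by positivity), mul_pow, r₂_sq hcu.le, hD2]; field_simp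

lemma eta2_nonneg (X : Matrix (Fin n) (Fin p) ℝ) (β : Fin p → ℝ) (A0 : Finset (Fin p)) :
    0 ≤ eta2 X β A0 :=
  le_trans (by simp) (Finset.le_sup' (fun A => ‖∑ j ∈ A, β j • designVec X j‖)
    (Finset.empty_mem_powerset A0))

/-- A model that contains all selected and all large indices, and whose small members all have
maximal correlation with the residual, has at most `M₁ q` members. -/
lemma IsKKT.card_le (hn : 0 < n) {X : Matrix (Fin n) (Fin p) ℝ} {qs q : ℕ} {cl cu η₁ : ℝ}
    (hX : SparseRiesz X qs cl cu) {β b : Fin p → ℝ} {A0 : Finset (Fin p)} (hq : 1 ≤ q)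
    (hβ : Sparsity β A0 q η₁) {ε : EuclideanSpace ℝ (Fin n)} {l : ℝ} (hl : 0 < l)
    (h : IsKKT X (linPred X β + ε) l b) {A : Finset (Fin p)} (hA : selected b ∪ A0ᶜ ⊆ A)
    (hA' : A ⊆ equiSet X (linPred X β + ε) l b ∪ A0ᶜ) (hAc : A.card ≤ qs)
    (hnoise : ∀ s : Fin p → ℝ, (∀ j ∈ A, s j = -1 ∨ s j = 0 ∨ s j = 1) →
      (A = ∅ ∨ ∃ j ∈ A, s j ≠ 0) → ∀ u ∈ noisePlane X β A s,
        ⟪ε, u⟫ ^ 2 ≤ l ^ 2 / (4 * (cu * n)) * (max A.card 1 : ℕ) * ‖u‖ ^ 2) :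
    (A.card : ℝ) ≤ M₁ n q η₁ (eta2 X β A0) cl cu l * q := by
  have hcl : 0 < cl := hX.2.1
  have hcu : 0 < cu := hcl.trans hX.2.2.1
  have hq' : (0 : ℝ) < q := by exact_mod_cast hq
  have hη₁ : 0 ≤ η₁ := le_trans (Finset.sum_nonneg fun j _ => abs_nonneg _) hβ.2
  obtain ⟨v, x, D, -, -, hD, hD2, hmain, -, hcard, -, hx0⟩ :=
    h.basic_inequality hn hX hq hβ hl (Finset.union_subset_left hA) hA'
      (by rwa [Finset.union_eq_left.2 (Finset.union_subset_right hA)]) hnoise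
  obtain ⟨h1, h2⟩ := eta_eq hn hq hcu hη₁ (eta2_nonneg X β A0) hl hD hD2
  rw [hx0 (Finset.union_subset_right hA), h1, mul_zero, add_zero] at hmain
  set ρ₁ := r₁ n q η₁ cu l with hρ₁
  set ρ₂ := r₂ n q (eta2 X β A0) cu l with hρ₂
  rw [h2] at hmain
  have hv := small_fit_bound hmain
  rw [Real.sq_sqrt (by positivity : 0 ≤ cu / cl)] at hv
  have h3 : ((A ∩ A0).card : ℝ) ≤ (1 + 4 * ρ₁ ^ 2 + 4 * √(cu / cl) * ρ₂ + 4 * (cu / cl)) * q := by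
    refine le_of_mul_le_mul_right (a := D ^ 2) ?_ (by positivity)
    nlinarith
  have h4 : (A.card : ℝ) ≤ (A ∩ A0).card + q := by
    rw [← hβ.1, ← Finset.card_inter_add_card_sdiff A A0]
    push_cast
    gcongr
    intro j hj
    exact Finset.mem_compl.2 (Finset.mem_sdiff.1 hj).2
  rw [M₁, ← hρ₁, ← hρ₂]
  linarith

lemma missedSq_eq (β b : Fin p → ℝ) (A0 : Finset (Fin p)) :
    missedSq β A0 b = ∑ j ∈ A0ᶜ \ selected b, β j ^ 2 := by
  rw [missedSq, ← Finset.sum_filter]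
  refine Finset.sum_congr ?_ fun j _ => sq_abs _
  ext j
  simp [selected]

/-- Bias and missed coefficients, from the basic inequality for the selected model itself. -/
lemma IsKKT.bias_and_missed_le (hn : 0 < n) {X : Matrix (Fin n) (Fin p) ℝ} {qs q : ℕ}
    {cl cu η₁ : ℝ} (hX : SparseRiesz X qs cl cu) {β b : Fin p → ℝ} {A0 : Finset (Fin p)}
    (hq : 1 ≤ q) (hβ : Sparsity β A0 q η₁) {ε : EuclideanSpace ℝ (Fin n)} {l : ℝ} (hl : 0 < l)
    (h : IsKKT X (linPred X β + ε) l b) (hAc : (selected b ∪ A0ᶜ).card ≤ qs)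
    (hnoise : ∀ s : Fin p → ℝ, (∀ j ∈ selected b, s j = -1 ∨ s j = 0 ∨ s j = 1) →
      (selected b = ∅ ∨ ∃ j ∈ selected b, s j ≠ 0) → ∀ u ∈ noisePlane X β (selected b) s,
        ⟪ε, u⟫ ^ 2 ≤ l ^ 2 / (4 * (cu * n)) * (max (selected b).card 1 : ℕ) * ‖u‖ ^ 2) :
    bias X β b ^ 2 ≤ M₂ n q η₁ (eta2 X β A0) cl cu l * (q * l ^ 2 / (cu * n)) ∧
      missedSq β A0 b
        ≤ M₃ n q η₁ (eta2 X β A0) cl cu l * (q * l ^ 2 / (cu * cl * n ^ 2)) := by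
  have hcl : 0 < cl := hX.2.1
  have hcu : 0 < cu := hcl.trans hX.2.2.1
  have hn' : (0 : ℝ) < n := by exact_mod_cast hn
  have hη₁ : 0 ≤ η₁ := le_trans (Finset.sum_nonneg fun j _ => abs_nonneg _) hβ.2
  obtain ⟨v, x, D, -, hx, hD, hD2, hmain, hxo, -, hmissed, -⟩ :=
    h.basic_inequality hn hX hq hβ hl subset_rfl
      ((h.selected_subset hl.le).trans Finset.subset_union_left) hAc hnoise
  obtain ⟨h1, h2⟩ := eta_eq hn hq hcu hη₁ (eta2_nonneg X β A0) hl hD hD2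
  have hbias : bias X β b = ‖unexplained X β (selected b)‖ := rfl
  rw [h1] at hmain
  rw [hbias, missedSq_eq]
  set o := ‖unexplained X β (selected b)‖
  have hρ₂0 : 0 ≤ r₂ n q (eta2 X β A0) cu l := Real.sqrt_nonneg _
  rw [M₂, M₃]
  set ρ₁ := r₁ n q η₁ cu l
  set ρ₂ := r₂ n q (eta2 X β A0) cu l
  rw [h2] at hmain hxo
  have hC : 0 < cu / cl := by positivity
  set C := cu / cl
  set t := √C with ht
  have ht2 : t ^ 2 = C := Real.sq_sqrt hC.le
  have ht0 : 0 ≤ t := Real.sqrt_nonneg _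
  have hxo' : x - o ≤ ρ₂ * D := (le_abs_self _).trans hxo
  constructor
  · refine (unexplained_bound hC.le hD.le ht2 hxo' hmain).trans ?_
    rw [← hD2]
    have e1 : t ≤ √(2 * C) := Real.sqrt_le_sqrt (by linarith)
    have e2 : ρ₂ * (t + C) ≤ ρ₂ * √(2 * C) * (1 + t) := by
      calc ρ₂ * (t + C) = ρ₂ * t * (1 + t) := by rw [← ht2]; ring
        _ ≤ _ := by gcongr
    refine mul_le_mul_of_nonneg_right ?_ (sq_nonneg D)
    nlinarith [sq_nonneg C]
  · have e0 := missed_bound hC.le ht0 ht2 hx hρ₂0 hxo' hmain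
    have e1 : t ≤ √(1 + C) := Real.sqrt_le_sqrt (by linarith)
    have e2 : ρ₂ * (t + 2 * C) ≤ ρ₂ * t * (1 + 2 * √(1 + C)) := by
      calc ρ₂ * (t + 2 * C) = ρ₂ * t * (1 + 2 * t) := by rw [← ht2]; ring
        _ ≤ _ := by gcongr
    have e3 : x ^ 2 ≤ 8 / 3 * (1 / 4 + ρ₁ ^ 2 + ρ₂ * t * (1 + 2 * √(1 + C)) + 3 * ρ₂ ^ 2 / 4
        + C * (7 / 6 + 2 / 3 * C)) * D ^ 2 := by
      refine e0.trans (mul_le_mul_of_nonneg_right ?_ (sq_nonneg D))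
      nlinarith
    refine le_of_mul_le_mul_left (a := cl * n) ?_ (by positivity)
    refine (hmissed.trans e3).trans (le_of_eq ?_)
    rw [hD2]
    field_simp

end Main

theorem theorem1 {n p : ℕ} (hn : 0 < n) (X : Matrix (Fin n) (Fin p) ℝ) (β : Fin p → ℝ)
    (c₀ a : ℝ) (hc₀ : 0 ≤ c₀) (ha : 0 ≤ a) :
    ∃ Ω₀ : Set (EuclideanSpace ℝ (Fin n)), MeasurableSet Ω₀ ∧
      ∀ {Ω : Type*} [MeasurableSpace Ω] (P : Measure Ω) [IsProbabilityMeasure P]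
        (ε : Ω → EuclideanSpace ℝ (Fin n)) (σ : ℝ), 0 < σ →
        HasLaw ε (multivariateGaussian 0 ((σ ^ 2) • (1 : Matrix (Fin n) (Fin n) ℝ))) P →
      ∀ (A0 : Finset (Fin p)) (q qs : ℕ) (η₁ cl cu : ℝ), 1 ≤ q →
        Sparsity β A0 q η₁ → SparseRiesz X qs cl cu →
        2 - Real.exp (2 * p / (max (p : ℝ) a) ^ (1 + c₀)) - 2 / (max (p : ℝ) a) ^ (1 + c₀)
            ≤ P.real {ω | σ⁻¹ • ε ω ∈ Ω₀} ∧
        ∀ ω, σ⁻¹ • ε ω ∈ Ω₀ →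
          ∀ l : ℝ,
            max (lamStar n q qs η₁ (eta2 X β A0) cl cu) (lamNP n p σ c₀ a cu : EReal) ≤ (l : EReal) →
          ∀ b : Fin p → ℝ, IsLasso X (linPred X β + ε ω) l b →
            ((selected b).card ≤ (Finset.univ.filter fun j => b j ≠ 0 ∨ j ∉ A0).card ∧
              ((Finset.univ.filter fun j => b j ≠ 0 ∨ j ∉ A0).card : ℝ)
                ≤ M₁ n q η₁ (eta2 X β A0) cl cu l * q) ∧
            bias X β b ^ 2 ≤ M₂ n q η₁ (eta2 X β A0) cl cu l * (q * l ^ 2 / (cu * n)) ∧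
            missedSq β A0 b
              ≤ M₃ n q η₁ (eta2 X β A0) cl cu l * (q * l ^ 2 / (cu * cl * n ^ 2)) := by
  refine ⟨goodEvent X β c₀ a, measurableSet_goodEvent X β c₀ a, ?_⟩
  intro Ω _ P _ ε σ hσ hε A0 q qs η₁ cl cu hq hβ hX
  have hp : 0 < p := by
    have h1 : A0ᶜ.card ≤ p := by simpa using Finset.card_le_univ A0ᶜ
    have := hβ.1
    omega
  have hcl : 0 < cl := hX.2.1
  have hcu : 0 < cu := hcl.trans hX.2.2.1
  have hη₁ : 0 ≤ η₁ := le_trans (Finset.sum_nonneg fun j _ => abs_nonneg _) hβ.2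
  have hq' : (1 : ℝ) ≤ q := by exact_mod_cast hq
  constructor
  · have hlaw := smul_hasLaw_stdGaussian hσ hε
    refine (goodEvent_prob X β hp hc₀).trans (le_of_eq ?_)
    rw [← hlaw.map_eq, map_measureReal_apply_of_aemeasurable hlaw.aemeasurable
      (measurableSet_goodEvent X β c₀ a)]
    rfl
  · intro ω hω l hl b hb
    have hlam := (le_max_left _ _).trans hl
    have hlnp : lamNP n p σ c₀ a cu ≤ l := EReal.coe_le_coe_iff.1 ((le_max_right _ _).trans hl)
    -- a finite `λ_*` forces `p ≥ 3`, so that `λ_{n,p}` and hence `l` are positive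
    have hp3 : 3 ≤ p := by
      obtain ⟨l', -, hl'⟩ := set_nonempty_of_lamStar_le hlam
      have h2 := two_le_M₁ (n := n) (q := q) (η₁ := η₁) (η₂ := eta2 X β A0) (l := l') hcl hcu
      have h3 : (3 : ℝ) ≤ qs := by nlinarith
      have h4 : 3 ≤ qs := by exact_mod_cast h3
      exact h4.trans hX.1
    have hl0 : 0 < l := by
      have h1 : (1 : ℝ) < max (p : ℝ) a := lt_max_of_lt_left (by exact_mod_cast (by omega : 1 < p))
      have h2 := Real.log_pos h1
      have hn' : (0 : ℝ) < n := by exact_mod_cast hn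
      refine lt_of_lt_of_le ?_ hlnp
      unfold lamNP
      positivity
    have hM := M₁_mul_add_one_le hq hη₁ hcu hl0 hlam
    have hkkt := hb.isKKT hl0.le
    have hfilter : (Finset.univ.filter fun j => b j ≠ 0 ∨ j ∉ A0) = selected b ∪ A0ᶜ := by
      ext j; simp [selected]
    have hcard : (selected b ∪ A0ᶜ).card < qs := by
      refine card_selected_union_lt hl0 ?_ ?_ hkkt
      · rw [hβ.1]
        have h2 := two_le_M₁ (n := n) (q := q) (η₁ := η₁) (η₂ := eta2 X β A0) (l := l) hcl hcu
        have : (q : ℝ) ≤ qs := by nlinarith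
        exact_mod_cast this
      · intro l' hl' b' hb' A hA hA' hAc
        have hl'0 := hl0.trans_le hl'
        have h1 := hb'.card_le hn hX hq hβ hl'0 hA hA' hAc
          (noise_bound_of_goodEvent hn hp hc₀ hσ hcu (hlnp.trans hl') hω A)
        have h2 := M₁_anti (n := n) (η₂ := eta2 X β A0) (cl := cl) hq hη₁ hcu hl0 hl'
        have h3 : (A.card : ℝ) < qs := by nlinarith
        exact_mod_cast h3
    have hnoise := noise_bound_of_goodEvent hn hp hc₀ hσ hcu hlnp hω
    rw [hfilter]
    exact ⟨⟨Finset.card_le_card Finset.subset_union_left,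
      hkkt.card_le hn hX hq hβ hl0 subset_rfl
        (Finset.union_subset_union_left (hkkt.selected_subset hl0.le)) hcard.le (hnoise _)⟩,
      hkkt.bias_and_missed_le hn hX hq hβ hl0 hcard.le (hnoise _)⟩
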